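/- Let $\alpha\ge|\beta|\ge 0$, $\delta,\lambda>0$, $\mu\in\mathbb R$, and let $(\widetilde W,\widetilde W^{\perp})$ be a standard two-dimensional Brownian motion started at $0$ (two independent standard real Brownian motions). For $u,v\in\mathbb R$ put $$\eta(u,v):=i\mu u+\delta\Big(\sqrt{\alpha^2-\beta^2}-\sqrt{\alpha^2-2i\lambda v-(\beta+iu)^2}\Big),$$ with the principal complex square root. For $t\ge 0$ define $$\Lambda_t:=\inf\Big\{s\ge 0:\ \sqrt{\alpha^2-\beta^2}\,s+\widetilde W_s\ge\delta t\Big\},\qquad Z_t:=\mu t+\beta\Lambda_t+\widetilde W^{\perp}_{\Lambda_t}.$$ Then $\Lambda_t<\infty$ almost surely for every $t\ge0$, and $$\mathbb E\big[\exp(iuZ_t+iv\lambda\Lambda_t)\big]=\exp(\eta(u,v)\,t),\qquad u,v\in\mathbb R,\ t\ge 0.$$ In particular, $\eta$ is the logarithm (continuous, with $\eta(0,0)=0$) of the characteristic function of $(Z_1,\lambda\Lambda_1)$, and the law of $(Z_1,\lambda\Lambda_1)$ is infinitely divisible. Consequently a NIG-IG process with parameters $(\alpha,\beta,\delta,\mu,\lambda)$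 exists: on some probability space there is a two-dimensional time-homogeneous Lévy process $(X_t,Y_t)_{t\ge0}$ with càdlàg sample paths and $(X_0,Y_0)=(0,0)$ almost surely such that $\mathbb E[\exp(iuX_t+ivY_t)]=\exp(\eta(u,v)t)$ for all $u,v\in\mathbb R$, $t\ge0$. -/

import Mathlib

open MeasureTheory ProbabilityTheory Filter Topology
open scoped NNReal

universe u

namespace NIGIG

/-- The NIG-IG exponent
`η(u,v) = iμu + δ(√(α² - β²) - √(α² - 2iλv - (β + iu)²))`.
The complex square root is the principal one, `z ^ (1/2)` (with value `0` at `z = 0`);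
for `|β| ≤ α` its argument has real part `α² - β² + u² ≥ 0`. -/
noncomputable def exponent (α β δ μ lam u v : ℝ) : ℂ :=
  Complex.I * μ * u +
    δ * ((Real.sqrt (α ^ 2 - β ^ 2) : ℂ) -
      ((α : ℂ) ^ 2 - 2 * Complex.I * lam * v - ((β : ℂ) + Complex.I * u) ^ 2) ^ (1 / 2 : ℂ))

/-- The characteristic function `E[exp(iuX + ivY)]` of a pair of real random variables. -/
noncomputable def jointCharFun {Ω : Type*} [MeasurableSpace Ω] (P : Measure Ω)
    (X Y : Ω → ℝ) (u v : ℝ) : ℂ :=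
  ∫ ω, Complex.exp (Complex.I * u * X ω + Complex.I * v * Y ω) ∂P

/-- A standard two-dimensional Brownian motion, given by its coordinates: two independent
real standard Brownian motions (started at `0`, with a.s. continuous paths). -/
structure IsBrownianPair {Ω : Type*} [MeasurableSpace Ω] (W W' : ℝ≥0 → Ω → ℝ)
    (P : Measure Ω) : Prop where
  fst : IsBrownianReal W P
  snd : IsBrownianReal W' P
  indep : IndepFun (fun ω t ↦ W t ω) (fun ω t ↦ W' t ω) P

/-- The times `s ≥ 0` at which the process `W` with drift `c` is at or above the level `x`. -/
def passageTimes {Ω : Type*} (c : ℝ) (W : ℝ≥0 → Ω → ℝ) (x : ℝ) (ω : Ω) : Set ℝ≥0 :=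
  {s | x ≤ c * s + W s ω}

/-- The first hitting time `Λ_t = inf {s ≥ 0 : √(α² - β²) s + W_s ≥ δ t}`. -/
noncomputable def hittingProcess {Ω : Type*} (α β δ : ℝ) (W : ℝ≥0 → Ω → ℝ)
    (t : ℝ≥0) (ω : Ω) : ℝ≥0 :=
  sInf (passageTimes (Real.sqrt (α ^ 2 - β ^ 2)) W (δ * t) ω)

/-- The shifted subordinated process `Z_t = μ t + β Λ_t + W'_{Λ_t}`. -/
noncomputable def subordinatedProcess {Ω : Type*} (α β δ μ : ℝ) (W W' : ℝ≥0 → Ω → ℝ)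
    (t : ℝ≥0) (ω : Ω) : ℝ :=
  μ * t + β * hittingProcess α β δ W t ω + W' (hittingProcess α β δ W t ω) ω

/-- A law on `ℝ²` is infinitely divisible: it is a probability measure and, for every `n ≥ 1`,
it is the law of the sum of `n` i.i.d. random vectors. -/
structure IsInfinitelyDivisible (m : Measure (ℝ × ℝ)) : Prop where
  isProbabilityMeasure : IsProbabilityMeasure m
  exists_root : ∀ n : ℕ, 1 ≤ n → ∃ ν : Measure (ℝ × ℝ), IsProbabilityMeasure ν ∧
    (Measure.pi fun _ : Fin n ↦ ν).map (fun x ↦ ∑ i, x i) = m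

/-- A two-dimensional (time-homogeneous) Lévy process with càdlàg sample paths: it starts from
`0` almost surely and has independent and stationary increments. (Continuity in probability
follows from these properties.) -/
structure IsLevyProcess {Ω : Type*} [MeasurableSpace Ω] (L : ℝ≥0 → Ω → ℝ × ℝ)
    (P : Measure Ω) : Prop where
  measurable : ∀ t, Measurable (L t)
  zero : ∀ᵐ ω ∂P, L 0 ω = 0
  indepIncrements : HasIndepIncrements L P
  stationary : ∀ s h : ℝ≥0,
    IdentDistrib (fun ω ↦ L (s + h) ω - L s ω) (fun ω ↦ L h ω - L 0 ω) P P
  rightContinuous : ∀ ω t, ContinuousWithinAt (fun s ↦ L s ω) (Set.Ici t) t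
  leftLimits : ∀ ω t, ∃ l, Tendsto (fun s ↦ L s ω) (𝓝[<] t) (𝓝 l)

/-- `L = (X, Y)` is a NIG-IG process with parameters `(α, β, δ, μ, λ)`. -/
structure IsProcess {Ω : Type*} [MeasurableSpace Ω] (α β δ μ lam : ℝ)
    (L : ℝ≥0 → Ω → ℝ × ℝ) (P : Measure Ω) : Prop extends IsLevyProcess L P where
  charFun_eq : ∀ (t : ℝ≥0) (u v : ℝ),
    jointCharFun P (fun ω ↦ (L t ω).1) (fun ω ↦ (L t ω).2) u v =
      Complex.exp (exponent α β δ μ lam u v * t)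

end NIGIG

/-!
Write `c = √(α² - β²)`, `X_s = c s + W_s`, and let `T_x` be the first time at which `X` is
strictly above the level `x`. With the strict inequality `T` is right-continuous in `x`, and it is
an optional time (`{T_x < s}` depends on the path up to `s`). The proof computes the joint
characteristic function of the increments of `(Z_t, λ T_{δt})`; everything else is read off from
it.

*Laplace transform.* For `Re ζ ≥ 0` let `θ` be the root of `θ² / 2 + c θ = ζ` with `Re θ ≥ 0`
(`laplaceExponent`). The exponential martingale `exp (θ W_s - θ² s / 2) = exp (θ X_s - ζ s)` has
mean one. On `{T_x < N}` the strong Markov property replaces its value at time `N` by its value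
`exp (θ x - ζ T_x)` at the passage time, and on the complement it is bounded by
`exp (Re θ x - Re ζ N)`. Hence `E[exp (-ζ T_x); T_x < ∞] = exp (-θ x)`; letting `ζ ↓ 0` gives
`T_x < ∞` almost surely (`ae_exists_lt`), and then `integral_cexp_passageTime`. The continuity of this transform in
`x` also shows that `T_x` almost surely equals the hitting time `Λ` of the theorem, defined by a
weak inequality (`passageTime_eq_sInf_ae`).

*Strong Markov property.* For an optional time `τ` the process restarted at `τ` is a Brownian
motion independent of `τ` (`isRegularBM_restart`, `indepFun_restart`): for times with values in a
grid this is the weak Markov property summed over the grid, and the general case follows by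
continuity of the paths. Applied at successive passage times it shows that the joint Laplace
transform of the increments of `T` factorizes (`integral_prod_cexp_increments`).

*Subordination.* Since `W'` is independent of `T`, freezing `T` turns the increments of `W'_T`
into Gaussian factors, and the increments of `(Z, λ T)` have a joint characteristic function that
is a product of factors `exp (η(u, v) (t - s))` (`integral_prod_cexp_levyPair`). So `(Z, λ T)` has
independent stationary increments, and its law at time `1` is the `n`-fold convolution of its law
at time `1 / n`. Its paths are càdlàg because `T` is monotone and right-continuous and `W'` is
continuous.

Almost sure properties of Brownian paths are first turned into sure ones by passing to a version
(`exists_regular_version`), so that no path is exceptional for the constructed process.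
-/

namespace NIGIG

variable {Ω : Type*} {mΩ : MeasurableSpace Ω} {P : Measure Ω}

/-! ### Regular versions of Brownian motion -/

/-- A Brownian motion whose coordinates are genuinely measurable and all of whose paths are
continuous and start at `0`, with no exceptional null set. -/
structure IsRegularBM (W : ℝ≥0 → Ω → ℝ) (P : Measure Ω) : Prop extends IsPreBrownianReal W P where
  measurable : ∀ t, Measurable (W t)
  continuous : ∀ ω, Continuous (W · ω)
  zero : ∀ ω, W 0 ω = 0

/-- A path property that implies continuity, that holds almost surely, and that is enjoyed by the
path `s ↦ s`, holds everywhere for a suitable measurable version of the process: the paths of a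
null set are replaced by `s ↦ s`. -/
lemma exists_version {Q : (ℝ≥0 → ℝ) → Prop} (hQ : ∀ f, Q f → Continuous f)
    (hQid : Q (fun s ↦ (s : ℝ))) {W : ℝ≥0 → Ω → ℝ} (hW : ∀ t, AEMeasurable (W t) P)
    (h : ∀ᵐ ω ∂P, Q (W · ω)) :
    ∃ V : ℝ≥0 → Ω → ℝ, (∀ t, Measurable (V t)) ∧ (∀ ω, Q (V · ω)) ∧
      ∀ᵐ ω ∂P, ∀ t, W t ω = V t ω := by
  classical
  set D := TopologicalSpace.denseSeq ℝ≥0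
  have hmk : ∀ᵐ ω ∂P, ∀ n, W (D n) ω = (hW (D n)).mk _ ω :=
    ae_all_iff.2 fun n ↦ (hW (D n)).ae_eq_mk
  obtain ⟨N, hN, hNm, hNP⟩ := (h.and hmk).exists_measurable_mem
  have hN' : ∀ ω ∈ N, Q (W · ω) ∧ ∀ n, W (D n) ω = (hW (D n)).mk _ ω := hNP
  refine ⟨fun t ω ↦ if ω ∈ N then W t ω else t, ?_, ?_, ?_⟩
  · have hD : ∀ n, Measurable (fun ω ↦ if ω ∈ N then W (D n) ω else (D n : ℝ)) := by
      intro n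
      have : (fun ω ↦ if ω ∈ N then W (D n) ω else (D n : ℝ)) =
          fun ω ↦ if ω ∈ N then (hW (D n)).mk _ ω else (D n : ℝ) := by
        ext ω
        split_ifs with hω
        · exact (hN' ω hω).2 n
        · rfl
      rw [this]
      exact Measurable.ite hNm (hW (D n)).measurable_mk measurable_const
    intro t
    obtain ⟨s, hsD, hst⟩ := mem_closure_iff_seq_limit.1
      ((TopologicalSpace.denseRange_denseSeq ℝ≥0) t)
    choose k hk using hsD
    refine measurable_of_tendsto_metrizable (f := fun n ω ↦ if ω ∈ N then W (s n) ω else (s n : ℝ))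
      (fun n ↦ ?_) ?_
    · rw [← hk n]; exact hD (k n)
    · rw [tendsto_pi_nhds]
      intro ω
      by_cases hω : ω ∈ N
      · simpa [hω, Function.comp_def] using ((hQ _ (hN' ω hω).1).tendsto t).comp hst
      · simpa only [hω, if_false, Function.comp_def] using (NNReal.continuous_coe.tendsto t).comp hst
  · intro ω
    by_cases hω : ω ∈ N
    · simpa [hω] using (hN' ω hω).1
    · simpa [hω] using hQid
  · filter_upwards [hN] with ω hω t
    simp [hω]

/-! ### First passage times over a level -/

section Passage

variable {c x : ℝ} {W : ℝ≥0 → Ω → ℝ}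

/-- The time at which `W` with drift `c` first exceeds the level `x`. The inequality is strict, so
that the passage time is right-continuous in `x`; it is `0` (the infimum of the empty set) when the
level is never exceeded. -/
noncomputable def passageTime (c : ℝ) (W : ℝ≥0 → Ω → ℝ) (x : ℝ) (ω : Ω) : ℝ≥0 :=
  sInf {s | x < c * s + W s ω}

/-- The passage time over the level `x`, or `N` if the level is not exceeded before. -/
noncomputable def cappedPassageTime (c : ℝ) (W : ℝ≥0 → Ω → ℝ) (x : ℝ) (N : ℝ≥0) (ω : Ω) : ℝ≥0 :=
  sInf ({s | x < c * s + W s ω} ∪ Set.Ici N)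

lemma cappedPassageTime_lt_iff {N s : ℝ≥0} {ω : Ω} :
    cappedPassageTime c W x N ω < s ↔ N < s ∨ ∃ r < s, x < c * r + W r ω := by
  rw [cappedPassageTime, csInf_lt_iff (OrderBot.bddBelow _) ⟨N, Or.inr Set.self_mem_Ici⟩]
  constructor
  · rintro ⟨r, hr | hr, hrs⟩
    · exact Or.inr ⟨r, hrs, hr⟩
    · exact Or.inl (lt_of_le_of_lt hr hrs)
  · rintro (h | ⟨r, hrs, hr⟩)
    · exact ⟨N, Or.inr Set.self_mem_Ici, h⟩
    · exact ⟨r, Or.inl hr, hrs⟩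

lemma passageTime_lt_iff {s : ℝ≥0} {ω : Ω} (h : ∃ r : ℝ≥0, x < c * r + W r ω) :
    passageTime c W x ω < s ↔ ∃ r < s, x < c * r + W r ω := by
  have hne : {s : ℝ≥0 | x < c * s + W s ω}.Nonempty := h
  rw [passageTime, csInf_lt_iff (OrderBot.bddBelow _) hne]
  exact ⟨fun ⟨r, hr, hrs⟩ ↦ ⟨r, hrs, hr⟩, fun ⟨r, hr, hrs⟩ ↦ ⟨r, hrs, hr⟩⟩

lemma cappedPassageTime_eq_passageTime {N : ℝ≥0} {ω : Ω} (h : ∃ r : ℝ≥0, x < c * r + W r ω)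
    (hN : passageTime c W x ω < N) : cappedPassageTime c W x N ω = passageTime c W x ω := by
  refine le_antisymm (csInf_le_csInf (OrderBot.bddBelow _) h Set.subset_union_left) ?_
  refine le_csInf ⟨N, Or.inr Set.self_mem_Ici⟩ ?_
  rintro s (hs | hs)
  · exact csInf_le (OrderBot.bddBelow _) hs
  · exact hN.le.trans hs

lemma measurableSet_exists_lt {m : MeasurableSpace Ω} {s : ℝ≥0}
    (hW : ∀ r ≤ s, Measurable[m] (W r)) (hc : ∀ ω, Continuous (W · ω)) :
    MeasurableSet[m] {ω | ∃ r < s, x < c * r + W r ω} := by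
  have : {ω | ∃ r < s, x < c * r + W r ω} =
      ⋃ n, ⋃ (_ : TopologicalSpace.denseSeq ℝ≥0 n < s),
        {ω | x < c * (TopologicalSpace.denseSeq ℝ≥0 n) + W (TopologicalSpace.denseSeq ℝ≥0 n) ω} := by
    ext ω
    simp only [Set.mem_ofPred_eq, Set.mem_iUnion, exists_prop]
    constructor
    · rintro ⟨r, hrs, hr⟩
      have hcω := hc ω
      have ho : IsOpen (Set.Iio s ∩ {r : ℝ≥0 | x < c * r + W r ω}) :=
        isOpen_Iio.inter (isOpen_lt continuous_const (by fun_prop))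
      obtain ⟨n, hn⟩ := (TopologicalSpace.denseRange_denseSeq ℝ≥0).exists_mem_open ho ⟨r, hrs, hr⟩
      exact ⟨n, hn⟩
    · rintro ⟨n, hns, hn⟩
      exact ⟨_, hns, hn⟩
  rw [this]
  refine MeasurableSet.iUnion fun n ↦ MeasurableSet.iUnion fun hn ↦ ?_
  exact measurableSet_lt measurable_const ((hW _ hn.le).const_add _)

lemma measurable_passageTime {m : MeasurableSpace Ω}
    (hW : ∀ r, Measurable[m] (W r)) (hc : ∀ ω, Continuous (W · ω))
    (h : ∀ ω, ∃ r : ℝ≥0, x < c * r + W r ω) : Measurable[m] (passageTime c W x) := by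
  refine measurable_of_Iio fun s ↦ ?_
  convert measurableSet_exists_lt (c := c) (x := x) (s := s) (m := m) (fun r _ ↦ hW r) hc using 1
  ext ω
  exact passageTime_lt_iff (h ω)

/-- Before the passage time the path is at most `x`, and by continuity so it is at that time. -/
lemma le_of_le_cappedPassageTime {N s : ℝ≥0} {ω : Ω} (hc : Continuous (W · ω)) (hx : 0 ≤ x)
    (h0 : W 0 ω = 0) (hs : s ≤ cappedPassageTime c W x N ω) : c * s + W s ω ≤ x := by
  by_contra! hlt
  have hs0 : s ≠ 0 := by
    rintro rfl
    simp [h0] at hlt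
    linarith
  have hcont : Continuous fun r : ℝ≥0 ↦ c * r + W r ω := by fun_prop
  have hev : ∀ᶠ r in 𝓝[<] s, x < c * r + W r ω :=
    (hcont.tendsto s).eventually_const_lt hlt |>.filter_mono nhdsWithin_le_nhds
  have : (𝓝[<] s).NeBot := nhdsLT_neBot_of_exists_lt ⟨0, pos_of_ne_zero hs0⟩
  obtain ⟨r, hr, hrs⟩ := (hev.and self_mem_nhdsWithin).exists
  have : cappedPassageTime c W x N ω < s := cappedPassageTime_lt_iff.2 (Or.inr ⟨r, hrs, hr⟩)
  exact absurd hs this.not_ge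

lemma apply_cappedPassageTime {N : ℝ≥0} {ω : Ω} (hc : Continuous (W · ω)) (hx : 0 ≤ x)
    (h0 : W 0 ω = 0) (hN : cappedPassageTime c W x N ω < N) :
    c * cappedPassageTime c W x N ω + W (cappedPassageTime c W x N ω) ω = x := by
  refine le_antisymm (le_of_le_cappedPassageTime hc hx h0 le_rfl) ?_
  by_contra! hlt
  have hcont : Continuous fun r : ℝ≥0 ↦ c * r + W r ω := by fun_prop
  obtain ⟨u, hu, hu'⟩ := exists_Ico_subset_of_mem_nhds
    ((hcont.tendsto _).eventually_lt_const hlt) ⟨N, hN⟩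
  have hlt' : cappedPassageTime c W x N ω < min u N := lt_min hu hN
  rcases cappedPassageTime_lt_iff.1 hlt' with h | ⟨r, hr, hrx⟩
  · exact absurd h (min_le_right _ _).not_gt
  · have h1 : cappedPassageTime c W x N ω ≤ r :=
      csInf_le (OrderBot.bddBelow _) (Or.inl hrx)
    have h2 := hu' ⟨h1, hr.trans_le (min_le_left _ _)⟩
    simp only [Set.mem_ofPred_eq] at h2
    linarith

lemma apply_passageTime {ω : Ω} (hc : Continuous (W · ω)) (hx : 0 ≤ x)
    (h0 : W 0 ω = 0) (h : ∃ r : ℝ≥0, x < c * r + W r ω) :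
    c * passageTime c W x ω + W (passageTime c W x ω) ω = x := by
  have hN : passageTime c W x ω < passageTime c W x ω + 1 := lt_add_one _
  have := cappedPassageTime_eq_passageTime h hN
  have := apply_cappedPassageTime (N := passageTime c W x ω + 1) hc hx h0 (by rwa [this])
  rwa [cappedPassageTime_eq_passageTime h hN] at this

lemma le_of_le_passageTime {ω : Ω} {s : ℝ≥0} (hc : Continuous (W · ω)) (hx : 0 ≤ x)
    (h0 : W 0 ω = 0) (h : ∃ r : ℝ≥0, x < c * r + W r ω) (hs : s ≤ passageTime c W x ω) :
    c * s + W s ω ≤ x := by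
  have hN : passageTime c W x ω < passageTime c W x ω + 1 := lt_add_one _
  refine le_of_le_cappedPassageTime (N := passageTime c W x ω + 1) hc hx h0 ?_
  rwa [cappedPassageTime_eq_passageTime h hN]

lemma passageTime_mono {ω : Ω} (h : ∀ x : ℝ, ∃ r : ℝ≥0, x < c * r + W r ω) :
    Monotone fun x ↦ passageTime c W x ω := fun _ y hxy ↦
  csInf_le_csInf (OrderBot.bddBelow _) (h y) fun _ hs ↦ hxy.trans_lt hs

/-- After the passage over `x`, the passage over `y ≥ x` is that of the restarted path over
`y - x`. -/
lemma passageTime_eq_add {y : ℝ} {ω : Ω} (hc : Continuous (W · ω)) (hx : 0 ≤ x) (hxy : x ≤ y)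
    (h0 : W 0 ω = 0) (h : ∀ x : ℝ, ∃ r : ℝ≥0, x < c * r + W r ω) :
    passageTime c W y ω = passageTime c W x ω +
      passageTime c (fun s ω ↦ W (passageTime c W x ω + s) ω - W (passageTime c W x ω) ω)
        (y - x) ω := by
  have hT := apply_passageTime hc hx h0 (h x)
  set T := passageTime c W x ω
  have key : ∀ s : ℝ≥0, y < c * (T + s : ℝ≥0) + W (T + s) ω ↔
      y - x < c * s + (W (T + s) ω - W T ω) := by
    intro s
    rw [NNReal.coe_add]
    constructor <;> intro h <;> linarith
  have hne : ∃ s : ℝ≥0, y - x < c * s + (W (T + s) ω - W T ω) := by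
    obtain ⟨r, hr⟩ := h y
    have hTr : T ≤ r := by
      by_contra! hlt
      have := le_of_le_passageTime hc hx h0 (h x) hlt.le
      linarith
    refine ⟨r - T, (key _).1 ?_⟩
    rwa [add_tsub_cancel_of_le hTr]
  apply le_antisymm
  · refine le_of_forall_gt fun u hu ↦ ?_
    replace hu := lt_tsub_iff_left.2 hu
    obtain ⟨r, hru, hr⟩ := (passageTime_lt_iff hne).1 hu
    have hle : passageTime c W y ω ≤ T + r := csInf_le (OrderBot.bddBelow _) ((key r).2 hr)
    exact hle.trans_lt (lt_tsub_iff_left.1 hru)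
  · refine le_csInf (h y) fun r hr ↦ ?_
    have hTr : T ≤ r := by
      by_contra! hlt
      have := le_of_le_passageTime hc hx h0 (h x) hlt.le
      simp only [Set.mem_ofPred_eq] at hr
      linarith
    have : passageTime c (fun s ω ↦ W (T + s) ω - W T ω) (y - x) ω ≤ r - T := by
      refine csInf_le (OrderBot.bddBelow _) ((key _).1 ?_)
      rwa [add_tsub_cancel_of_le hTr]
    calc _ ≤ T + (r - T) := by gcongr; exact this
      _ = r := add_tsub_cancel_of_le hTr

/-- The passage time is right-continuous in the level. -/
lemma continuousWithinAt_passageTime {ω : Ω} (h : ∀ x : ℝ, ∃ r : ℝ≥0, x < c * r + W r ω) (x : ℝ) :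
    ContinuousWithinAt (fun x ↦ passageTime c W x ω) (Set.Ici x) x := by
  refine tendsto_order.2 ⟨fun a ha ↦ ?_, fun a ha ↦ ?_⟩
  · filter_upwards [self_mem_nhdsWithin] with y hy
    exact ha.trans_le (passageTime_mono h hy)
  · obtain ⟨r, hr, hrx⟩ := (passageTime_lt_iff (h x)).1 ha
    filter_upwards [mem_nhdsWithin_of_mem_nhds (Iio_mem_nhds hrx)] with y hy
    exact (passageTime_lt_iff (h y)).2 ⟨r, hr, hy⟩

end Passage

/-! ### The strong Markov property -/

section StrongMarkov

open scoped BoundedContinuousFunction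

variable {W : ℝ≥0 → Ω → ℝ} {τ : Ω → ℝ≥0}

/-- The `σ`-algebra generated by the process up to time `s`. -/
@[reducible]
def past (W : ℝ≥0 → Ω → ℝ) (s : ℝ≥0) : MeasurableSpace Ω :=
  MeasurableSpace.comap (fun ω (r : Set.Iic s) ↦ W r ω) inferInstance

/-- The process restarted at the random time `τ`. -/
def restart (W : ℝ≥0 → Ω → ℝ) (τ : Ω → ℝ≥0) (s : ℝ≥0) (ω : Ω) : ℝ :=
  W (τ ω + s) ω - W (τ ω) ω

/-- An optional time: `{τ < s}` is determined by the path up to time `s`. This is weaker than being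
a stopping time, and is what passage times over a level satisfy. -/
def IsOptionalTime (W : ℝ≥0 → Ω → ℝ) (τ : Ω → ℝ≥0) : Prop :=
  ∀ s, MeasurableSet[past W s] {ω | τ ω < s}

lemma measurable_past {s r : ℝ≥0} (hrs : r ≤ s) : Measurable[past W s] (W r) :=
  (measurable_pi_apply (⟨r, hrs⟩ : Set.Iic s)).comp
    (comap_measurable (fun ω (r : Set.Iic s) ↦ W r ω))

lemma past_mono : Monotone (past W) := by
  intro s t hst
  refine (@measurable_pi_lambda _ _ _ (past W t) _ _ fun r ↦ ?_).comap_le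
  exact measurable_past (r.2.trans hst)

lemma past_le (hW : ∀ t, Measurable (W t)) (s : ℝ≥0) : past W s ≤ mΩ :=
  Measurable.comap_le (measurable_pi_lambda _ fun r ↦ hW r)

lemma IsOptionalTime.measurable_min (hτ : IsOptionalTime W τ) (s : ℝ≥0) :
    Measurable[past W s] fun ω ↦ min (τ ω) s := by
  refine measurable_of_Iio fun r ↦ ?_
  rcases le_or_gt r s with hrs | hrs
  · convert past_mono hrs _ (hτ r) using 1
    ext ω
    simp [hrs]
  · convert MeasurableSet.univ
    ext ω
    simp [hrs]

lemma IsOptionalTime.measurable (hτ : IsOptionalTime W τ) (hW : ∀ t, Measurable (W t)) :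
    Measurable τ :=
  measurable_of_Iio fun s ↦ past_le hW s _ (hτ s)

lemma isOptionalTime_passageTime {c x : ℝ} (hc : ∀ ω, Continuous (W · ω))
    (h : ∀ ω, ∃ r : ℝ≥0, x < c * r + W r ω) : IsOptionalTime W (passageTime c W x) := by
  intro s
  convert measurableSet_exists_lt (c := c) (x := x) (fun r hr ↦ measurable_past (W := W) hr) hc
    using 1
  ext ω
  exact passageTime_lt_iff (h ω)

lemma isOptionalTime_cappedPassageTime {c x : ℝ} {N : ℝ≥0} (hc : ∀ ω, Continuous (W · ω)) :
    IsOptionalTime W (cappedPassageTime c W x N) := by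
  intro s
  have := measurableSet_exists_lt (c := c) (x := x) (fun r hr ↦ measurable_past (W := W) hr) hc
    (s := s)
  convert (MeasurableSet.const (N < s)).union this using 1
  ext ω
  exact cappedPassageTime_lt_iff

lemma measurable_restart (hW : ∀ t, Measurable (W t)) (hc : ∀ ω, Continuous (W · ω))
    (hτ : Measurable τ) (s : ℝ≥0) : Measurable (restart W τ s) := by
  have hu : Measurable (Function.uncurry W) :=
    measurable_uncurry_of_continuous_of_measurable hc hW
  exact (hu.comp ((hτ.add_const s).prodMk measurable_id)).sub (hu.comp (hτ.prodMk measurable_id))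

/-- The restarted process at a fixed time does not depend on the past. -/
lemma integral_mul_restart_const [IsProbabilityMeasure P] (hW : IsRegularBM W P) {s : ℝ≥0}
    {f : Ω → ℝ} (hf : Measurable[past W s] f) (J : Finset ℝ≥0) (g : (J → ℝ) →ᵇ ℝ) :
    ∫ ω, f ω * g (fun j ↦ W (s + j) ω - W s ω) ∂P =
      (∫ ω, f ω ∂P) * ∫ ω, g (fun j ↦ W j ω) ∂P := by
  have hindep : IndepFun f (fun ω ↦ g (fun j : J ↦ W (s + j) ω - W s ω)) P := by
    have h1 := (hW.toIsPreBrownianReal.indepFun_shift s).symm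
    have h2 : IndepFun (fun ω (t : Set.Iic s) ↦ W t ω)
        (fun ω ↦ g (fun j : J ↦ W (s + j) ω - W s ω)) P :=
      h1.comp (φ := id) (ψ := fun p : ℝ≥0 → ℝ ↦ g (fun j : J ↦ p j)) measurable_id
        (g.continuous.measurable.comp (by fun_prop))
    exact indep_of_indep_of_le_left h2 hf.comap_le
  have hm : ∀ t, Measurable (W t) := hW.measurable
  rw [hindep.integral_fun_mul_eq_mul_integral]
  · congr 1
    have e1 := (hW.toIsPreBrownianReal.shift s).hasLaw J
    have e2 := hW.toIsPreBrownianReal.hasLaw J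
    have h1 := e1.integral_comp (f := g) g.continuous.aestronglyMeasurable
    have h2 := e2.integral_comp (f := g) g.continuous.aestronglyMeasurable
    exact h1.trans h2.symm
  · exact (hf.mono (past_le hm s) le_rfl).aestronglyMeasurable
  · exact (g.continuous.measurable.comp (by fun_prop)).aestronglyMeasurable

/-- The smallest number of the form `k / (n + 1)`, `k ∈ ℕ`, exceeding `r`. -/
noncomputable def gridAbove (n : ℕ) (r : ℝ≥0) : ℝ≥0 := (⌊r * (n + 1)⌋₊ + 1) / (n + 1)

lemma lt_gridAbove (n : ℕ) (r : ℝ≥0) : r < gridAbove n r := by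
  rw [gridAbove, lt_div_iff₀ (by positivity)]
  exact Nat.lt_floor_add_one _

lemma tendsto_gridAbove (r : ℝ≥0) : Tendsto (fun n ↦ gridAbove n r) atTop (𝓝 r) := by
  have h1 : Tendsto (fun n : ℕ ↦ r + 1 / ((n : ℝ≥0) + 1)) atTop (𝓝 r) := by
    simpa using tendsto_const_nhds.add (tendsto_one_div_add_atTop_nhds_zero_nat (𝕜 := ℝ≥0))
  refine tendsto_of_tendsto_of_tendsto_of_le_of_le tendsto_const_nhds h1
    (fun n ↦ (lt_gridAbove n r).le) fun n ↦ ?_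
  have : (⌊r * (n + 1)⌋₊ : ℝ≥0) ≤ r * (n + 1) := Nat.floor_le zero_le
  rw [gridAbove, add_div]
  gcongr
  rwa [div_le_iff₀ (by positivity)]

/-- The strong Markov property for the grid approximations of an optional time, proved by
summing the weak Markov property over the values of the approximation. -/
lemma integral_mul_restart_gridAbove [IsProbabilityMeasure P] (hW : IsRegularBM W P)
    (hτ : IsOptionalTime W τ) (f : ℝ≥0 →ᵇ ℝ) (J : Finset ℝ≥0) (g : (J → ℝ) →ᵇ ℝ) (n : ℕ) :
    ∫ ω, f (τ ω) * g (fun j ↦ restart W (fun ω ↦ gridAbove n (τ ω)) j ω) ∂P =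
      (∫ ω, f (τ ω) ∂P) * ∫ ω, g (fun j ↦ W j ω) ∂P := by
  have hτm := hτ.measurable hW.measurable
  have hgrid : Measurable (gridAbove n) := by
    unfold gridAbove
    fun_prop
  have hr := measurable_restart hW.measurable hW.continuous (hgrid.comp hτm)
  set A : ℕ → Set Ω := fun k ↦ {ω | ⌊τ ω * (n + 1)⌋₊ = k} with hA
  have hAm : ∀ k, MeasurableSet (A k) := fun k ↦ by
    have : Measurable fun ω ↦ ⌊τ ω * (n + 1)⌋₊ := Nat.measurable_floor.comp (hτm.mul_const _)
    exact this (measurableSet_singleton k)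
  have hdisj : Pairwise (Function.onFun Disjoint A) := by
    intro i j hij
    refine Set.disjoint_left.2 fun ω hi hj ↦ hij ?_
    exact hi.symm.trans hj
  have hU : ⋃ k, A k = Set.univ := Set.eq_univ_of_forall fun ω ↦ Set.mem_iUnion.2 ⟨_, rfl⟩
  have hfi : Integrable (fun ω ↦ f (τ ω)) P :=
    Integrable.of_bound (f.continuous.measurable.comp hτm).aestronglyMeasurable ‖f‖
      (ae_of_all _ fun ω ↦ f.norm_coe_le_norm _)
  have hfgi : Integrable
      (fun ω ↦ f (τ ω) * g (fun j ↦ restart W (fun ω ↦ gridAbove n (τ ω)) j ω)) P := by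
    refine hfi.mul_bdd (c := ‖g‖) ?_ (ae_of_all _ fun ω ↦ g.norm_coe_le_norm _)
    exact (g.continuous.measurable.comp
      (measurable_pi_lambda _ fun j ↦ hr j)).aestronglyMeasurable
  have hk : ∀ k, ∫ ω in A k, f (τ ω) * g (fun j ↦ restart W (fun ω ↦ gridAbove n (τ ω)) j ω) ∂P =
      (∫ ω in A k, f (τ ω) ∂P) * ∫ ω, g (fun j ↦ W j ω) ∂P := by
    intro k
    set s : ℝ≥0 := (k + 1) / (n + 1) with hs
    set h : ℝ≥0 → ℝ := {r : ℝ≥0 | ⌊r * (n + 1)⌋₊ = k}.indicator f with hh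
    have hhm : Measurable h := by
      refine f.continuous.measurable.indicator ?_
      have : Measurable fun r : ℝ≥0 ↦ ⌊r * (n + 1)⌋₊ :=
        Nat.measurable_floor.comp (measurable_id.mul_const _)
      exact this (measurableSet_singleton k)
    -- On `A k` one has `τ < s`, and `s` itself lies outside the `k`-th cell.
    have hind : (A k).indicator (fun ω ↦ f (τ ω)) = fun ω ↦ h (min (τ ω) s) := by
      have hcell : ∀ r : ℝ≥0, ⌊r * (n + 1)⌋₊ = k → r < s := by
        intro r hr
        have := lt_gridAbove n r
        rwa [gridAbove, hr] at this
      ext ω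
      rcases lt_or_ge (τ ω) s with hlt | hge
      · rw [min_eq_left hlt.le]
        rfl
      · rw [min_eq_right hge, Set.indicator_of_notMem, hh, Set.indicator_of_notMem]
        · exact fun h ↦ lt_irrefl _ (hcell s h)
        · exact fun h ↦ (hcell _ h).not_ge hge
    have hpast : Measurable[past W s] fun ω ↦ h (min (τ ω) s) :=
      hhm.comp (hτ.measurable_min s)
    rw [← integral_indicator (hAm k), ← integral_indicator (hAm k), hind,
      ← integral_mul_restart_const hW hpast J g]
    congr 1
    ext ω
    rw [← congrFun hind ω]
    by_cases hω : ω ∈ A k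
    · have : gridAbove n (τ ω) = s := by
        have h' : ⌊τ ω * (n + 1)⌋₊ = k := hω
        rw [gridAbove, h']
      simp [hω, restart, this]
    · simp [hω]
  rw [← setIntegral_univ, ← hU, integral_iUnion hAm hdisj hfgi.integrableOn]
  simp_rw [hk]
  rw [tsum_mul_right, ← integral_iUnion hAm hdisj hfi.integrableOn, hU, setIntegral_univ]

lemma integral_mul_restart [IsProbabilityMeasure P] (hW : IsRegularBM W P)
    (hτ : IsOptionalTime W τ) (f : ℝ≥0 →ᵇ ℝ) (J : Finset ℝ≥0) (g : (J → ℝ) →ᵇ ℝ) :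
    ∫ ω, f (τ ω) * g (fun j ↦ restart W τ j ω) ∂P =
      (∫ ω, f (τ ω) ∂P) * ∫ ω, g (fun j ↦ W j ω) ∂P := by
  have hτm := hτ.measurable hW.measurable
  have hlim : Tendsto
      (fun n ↦ ∫ ω, f (τ ω) * g (fun j ↦ restart W (fun ω ↦ gridAbove n (τ ω)) j ω) ∂P) atTop
      (𝓝 (∫ ω, f (τ ω) * g (fun j ↦ restart W τ j ω) ∂P)) := by
    refine tendsto_integral_of_dominated_convergence (fun _ ↦ ‖f‖ * ‖g‖) (fun n ↦ ?_)
      (integrable_const _) (fun n ↦ ae_of_all _ fun ω ↦ ?_) (ae_of_all _ fun ω ↦ ?_)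
    · have hgrid : Measurable (gridAbove n) := by
        unfold gridAbove
        fun_prop
      have hr := measurable_restart hW.measurable hW.continuous (hgrid.comp hτm)
      exact ((f.continuous.measurable.comp hτm).mul (g.continuous.measurable.comp
        (measurable_pi_lambda _ fun j ↦ hr j))).aestronglyMeasurable
    · rw [norm_mul]
      gcongr
      · exact f.norm_coe_le_norm _
      · exact g.norm_coe_le_norm _
    · refine Tendsto.const_mul _ ((g.continuous.tendsto _).comp (tendsto_pi_nhds.2 fun j ↦ ?_))
      have hc := hW.continuous ω
      have hg := tendsto_gridAbove (τ ω)
      exact ((hc.tendsto _).comp (hg.add_const _)).sub ((hc.tendsto _).comp hg)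
  refine tendsto_nhds_unique hlim ?_
  simp_rw [integral_mul_restart_gridAbove hW hτ f J g]
  exact tendsto_const_nhds

/-- **Strong Markov property**, first half: the process restarted at an optional time is again a
Brownian motion. -/
lemma isRegularBM_restart [IsProbabilityMeasure P] (hW : IsRegularBM W P)
    (hτ : IsOptionalTime W τ) : IsRegularBM (restart W τ) P where
  hasLaw J := by
    have hm := measurable_restart hW.measurable hW.continuous (hτ.measurable hW.measurable)
    have hm' : Measurable fun ω ↦ J.restrict (restart W τ · ω) :=
      measurable_pi_lambda _ fun j ↦ hm j
    have hmW : Measurable fun ω ↦ J.restrict (W · ω) :=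
      measurable_pi_lambda _ fun j ↦ hW.measurable j
    refine ⟨hm'.aemeasurable, ?_⟩
    rw [← (hW.hasLaw J).map_eq]
    have := Measure.isProbabilityMeasure_map (μ := P) hm'.aemeasurable
    have := Measure.isProbabilityMeasure_map (μ := P) hmW.aemeasurable
    refine ext_of_forall_integral_eq_of_IsFiniteMeasure fun g ↦ ?_
    rw [integral_map hm'.aemeasurable g.continuous.aestronglyMeasurable,
      integral_map hmW.aemeasurable g.continuous.aestronglyMeasurable]
    simpa [Finset.restrict_def] using
      integral_mul_restart hW hτ (BoundedContinuousFunction.const _ 1) J g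
  measurable := measurable_restart hW.measurable hW.continuous (hτ.measurable hW.measurable)
  continuous ω := by
    have := hW.continuous ω
    unfold restart
    fun_prop
  zero ω := by simp [restart]

/-- **Strong Markov property**, second half: the process restarted at an optional time is
independent of that time. -/
lemma indepFun_restart [IsProbabilityMeasure P] (hW : IsRegularBM W P)
    (hτ : IsOptionalTime W τ) : IndepFun τ (fun ω s ↦ restart W τ s ω) P := by
  have hτm := hτ.measurable hW.measurable
  refine indepFun_process_of_bcf hτm.aemeasurable
    (fun t ↦ ((isRegularBM_restart hW hτ).measurable t).aemeasurable) fun f J g ↦ ?_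
  have h1 := integral_mul_restart hW hτ f J g
  have h2 := integral_mul_restart hW hτ (BoundedContinuousFunction.const _ 1) J g
  simp only [BoundedContinuousFunction.const_apply, one_mul, integral_const, probReal_univ,
    smul_eq_mul, mul_one] at h2
  rw [← h2] at h1
  exact h1

/-- Freezing: in the expectation of a function of two independent quantities, the first one may be
integrated out last. -/
lemma integral_eq_integral_integral_of_indepFun {E F : Type*} {mE : MeasurableSpace E}
    {mF : MeasurableSpace F} [IsProbabilityMeasure P] {Y : Ω → E} {V : Ω → F} (hY : Measurable Y)
    (hV : Measurable V) (h : IndepFun Y V P) {Φ : E → F → ℂ} (hΦ : Measurable (Function.uncurry Φ))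
    (hint : Integrable (fun ω ↦ Φ (Y ω) (V ω)) P) :
    ∫ ω, Φ (Y ω) (V ω) ∂P = ∫ ω, ∫ ω', Φ (Y ω) (V ω') ∂P ∂P := by
  have hprod := (indepFun_iff_map_prod_eq_prod_map_map hY.aemeasurable hV.aemeasurable).1 h
  have hpair := hY.prodMk hV
  have := Measure.isProbabilityMeasure_map (μ := P) hY.aemeasurable
  have := Measure.isProbabilityMeasure_map (μ := P) hV.aemeasurable
  have hint' : Integrable (Function.uncurry Φ) ((P.map Y).prod (P.map V)) := by
    rw [← hprod, integrable_map_measure hΦ.aestronglyMeasurable hpair.aemeasurable]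
    exact hint
  have h1 : ∫ ω, Φ (Y ω) (V ω) ∂P = ∫ p, Function.uncurry Φ p ∂(P.map fun ω ↦ (Y ω, V ω)) :=
    (integral_map hpair.aemeasurable hΦ.aestronglyMeasurable).symm
  rw [h1, hprod, integral_prod _ hint', integral_map hY.aemeasurable
    hΦ.stronglyMeasurable.integral_prod_right'.aestronglyMeasurable]
  refine integral_congr_ae (ae_of_all _ fun ω ↦ ?_)
  have : Measurable fun v ↦ Function.uncurry Φ (Y ω, v) := hΦ.comp measurable_prodMk_left
  exact integral_map hV.aemeasurable this.aestronglyMeasurable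

/-- The `σ`-algebra generated by a process; it renders a process with continuous paths jointly
measurable, which the product `σ`-algebra on path space does not. -/
@[reducible]
def generated (V : ℝ≥0 → Ω → ℝ) : MeasurableSpace Ω :=
  MeasurableSpace.comap (fun ω s ↦ V s ω) inferInstance

lemma measurable_generated (V : ℝ≥0 → Ω → ℝ) (s : ℝ≥0) : Measurable[generated V] (V s) :=
  (measurable_pi_apply s).comp (comap_measurable (fun ω s ↦ V s ω))

lemma generated_le {V : ℝ≥0 → Ω → ℝ} (hV : ∀ t, Measurable (V t)) : generated V ≤ mΩ :=
  Measurable.comap_le (measurable_pi_lambda _ hV)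

/-- Freezing of a random variable `Y` that is independent of a process `V`. -/
lemma integral_eq_integral_integral_of_indepFun_process {E : Type*} {mE : MeasurableSpace E}
    [IsProbabilityMeasure P] {Y : Ω → E} {V : ℝ≥0 → Ω → ℝ} (hY : Measurable Y)
    (hV : ∀ t, Measurable (V t)) (h : IndepFun Y (fun ω s ↦ V s ω) P) {Φ : E → Ω → ℂ}
    (hΦ : Measurable[Prod.instMeasurableSpace (m₂ := generated V)] (Function.uncurry Φ))
    (hint : Integrable (fun ω ↦ Φ (Y ω) ω) P) :
    ∫ ω, Φ (Y ω) ω ∂P = ∫ ω, ∫ ω', Φ (Y ω) ω' ∂P ∂P := by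
  have hind : @IndepFun Ω E Ω mΩ _ (generated V) Y id P := by
    rw [@IndepFun_iff_Indep] at h ⊢
    rwa [MeasurableSpace.comap_id]
  exact @integral_eq_integral_integral_of_indepFun Ω mΩ P E Ω mE (generated V) _ Y id hY
    (measurable_id'' (generated_le hV)) hind Φ hΦ hint

end StrongMarkov

/-! ### The Laplace transform of the passage times -/

section Laplace

open Complex

/-- The Laplace exponent `θ` of the passage times of a Brownian motion with drift `c`: the root of
`θ² / 2 + c θ = ζ` with nonnegative real part. -/
noncomputable def laplaceExponent (c : ℝ) (ζ : ℂ) : ℂ := -c + ((c : ℂ) ^ 2 + 2 * ζ) ^ (1 / 2 : ℂ)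

lemma laplaceExponent_spec (c : ℝ) (ζ : ℂ) :
    laplaceExponent c ζ ^ 2 / 2 + c * laplaceExponent c ζ = ζ := by
  have h : (((c : ℂ) ^ 2 + 2 * ζ) ^ (1 / 2 : ℂ)) ^ 2 = (c : ℂ) ^ 2 + 2 * ζ := by
    rw [one_div]
    exact cpow_ofNat_inv_pow _ 2
  rw [laplaceExponent]
  linear_combination h / 2

lemma laplaceExponent_re_nonneg {c : ℝ} {ζ : ℂ} (hζ : 0 ≤ ζ.re) :
    0 ≤ (laplaceExponent c ζ).re := by
  have hre : ((c : ℂ) ^ 2 + 2 * ζ).re = c ^ 2 + 2 * ζ.re := by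
    simp [← ofReal_pow]
  have h1 := re_le_norm ((c : ℂ) ^ 2 + 2 * ζ)
  rw [laplaceExponent, one_div, add_re, cpow_inv_two_re, neg_re, ofReal_re, ← sub_eq_neg_add,
    sub_nonneg]
  refine Real.le_sqrt_of_sq_le ?_
  rw [hre] at *
  linarith

lemma continuousAt_laplaceExponent {c : ℝ} {ζ : ℂ} (hζ : 0 ≤ ζ.re) :
    ContinuousAt (laplaceExponent c) ζ := by
  unfold laplaceExponent
  refine continuousAt_const.add (ContinuousAt.comp (f := fun ζ : ℂ ↦ (c : ℂ) ^ 2 + 2 * ζ)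
    (g := fun z : ℂ ↦ z ^ (1 / 2 : ℂ)) ?_ (by fun_prop))
  refine continuousAt_cpow_const_of_re_pos (Or.inl ?_) (by norm_num)
  have hre : ((c : ℂ) ^ 2 + 2 * ζ).re = c ^ 2 + 2 * ζ.re := by
    simp [← ofReal_pow]
  rw [hre]
  positivity

lemma laplaceExponent_zero {c : ℝ} (hc : 0 ≤ c) : laplaceExponent c 0 = 0 := by
  have h : ((c : ℂ) ^ 2) ^ (1 / 2 : ℂ) = c := by
    have h2 := (ofReal_cpow (sq_nonneg c) (1 / 2)).symm
    push_cast at h2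
    rw [h2, ← Real.sqrt_eq_rpow, Real.sqrt_sq hc]
  rw [laplaceExponent, mul_zero, add_zero, h, neg_add_cancel]

/-- Frequencies with `Re ζ = 0` are reached from the open half-plane `Re ζ > 0`, where the
exponential `exp (-ζ N)` decays. -/
lemma tendsto_laplaceExponent_add {c : ℝ} {ζ : ℂ} (hζ : 0 ≤ ζ.re) :
    Tendsto (fun n : ℕ ↦ laplaceExponent c (ζ + 1 / ((n : ℂ) + 1))) atTop
      (𝓝 (laplaceExponent c ζ)) := by
  refine (continuousAt_laplaceExponent hζ).tendsto.comp ?_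
  simpa using tendsto_const_nhds.add (tendsto_one_div_add_atTop_nhds_zero_nat (𝕜 := ℂ))

variable {W : ℝ≥0 → Ω → ℝ} {c x : ℝ} {ζ : ℂ}

lemma integrable_cexp_mul (hW : IsRegularBM W P) (θ : ℂ) (t : ℝ≥0) :
    Integrable (fun ω ↦ cexp (θ * W t ω)) P := by
  have hm := (hW.measurable t)
  refine (integrable_norm_iff (by fun_prop)).1 ?_
  have h := integrable_exp_mul_gaussianReal (μ := 0) (v := t) θ.re
  rw [← (hW.hasLaw_eval t).map_eq, integrable_map_measure (by fun_prop) hm.aemeasurable] at h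
  refine h.congr (ae_of_all _ fun ω ↦ ?_)
  simp [norm_exp]

/-- The exponential martingale `exp(θ W_t - θ² t / 2)` has mean one. -/
lemma integral_cexp_martingale (hW : IsRegularBM W P) (θ : ℂ) (t : ℝ≥0) :
    ∫ ω, cexp (θ * W t ω - θ ^ 2 * t / 2) ∂P = 1 := by
  have h := complexMGF_gaussianReal (hW.hasLaw_eval t).map_eq θ
  rw [complexMGF] at h
  simp_rw [sub_eq_add_neg, Complex.exp_add]
  rw [integral_mul_const, h, ← Complex.exp_add, ← Complex.exp_zero]
  congr 1
  push_cast
  ring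

lemma integrable_cexp_martingale (hW : IsRegularBM W P) (θ : ℂ) (t : ℝ≥0) :
    Integrable (fun ω ↦ cexp (θ * W t ω - θ ^ 2 * t / 2)) P := by
  simp_rw [sub_eq_add_neg, Complex.exp_add]
  exact (integrable_cexp_mul hW θ t).mul_const _

/-- Optional stopping, on the event that the level is passed before `N`: the exponential
martingale at time `N` may be replaced by its value at the passage time. -/
lemma setIntegral_cexp_martingale [IsProbabilityMeasure P] (hW : IsRegularBM W P) (hx : 0 ≤ x)
    {θ : ℂ} (hθ : θ ^ 2 / 2 + c * θ = ζ) (N : ℝ≥0) :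
    ∫ ω in {ω | cappedPassageTime c W x N ω < N}, cexp (θ * W N ω - θ ^ 2 * N / 2) ∂P =
      ∫ ω in {ω | cappedPassageTime c W x N ω < N},
        cexp (θ * x - ζ * cappedPassageTime c W x N ω) ∂P := by
  set τ := cappedPassageTime c W x N with hτdef
  have hτ : IsOptionalTime W τ := isOptionalTime_cappedPassageTime hW.continuous
  have hτm := hτ.measurable hW.measurable
  have hA : MeasurableSet {ω | τ ω < N} := measurableSet_lt hτm measurable_const
  have hV := isRegularBM_restart hW hτ
  set V := restart W τ with hVdef
  let G : ℝ≥0 → ℂ := (Set.Iio N).indicator fun s ↦ cexp (θ * x - ζ * s)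
  let Φ : ℝ≥0 → Ω → ℂ := fun s ω ↦
    G s * cexp (θ * V (N - s) ω - θ ^ 2 * (N - s : ℝ≥0) / 2)
  have hGm : Measurable G := Measurable.indicator (by fun_prop) measurableSet_Iio
  have hΦm : Measurable[Prod.instMeasurableSpace (m₂ := generated V)] (Function.uncurry Φ) := by
    let _ : MeasurableSpace Ω := generated V
    have hu : Measurable (Function.uncurry V) :=
      measurable_uncurry_of_continuous_of_measurable hV.continuous (measurable_generated V)
    have h1 : Measurable fun p : ℝ≥0 × Ω ↦ V (N - p.1) p.2 :=
      hu.comp ((measurable_const.sub measurable_fst).prodMk measurable_snd)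
    have h2 : Measurable fun p : ℝ≥0 × Ω ↦ G p.1 := hGm.comp measurable_fst
    have h3 : Measurable fun p : ℝ≥0 × Ω ↦ N - p.1 := measurable_const.sub measurable_fst
    change Measurable fun p : ℝ≥0 × Ω ↦
      G p.1 * cexp (θ * V (N - p.1) p.2 - θ ^ 2 * (N - p.1 : ℝ≥0) / 2)
    fun_prop
  have hsplit : (fun ω ↦ Φ (τ ω) ω) = {ω | τ ω < N}.indicator
      fun ω ↦ cexp (θ * W N ω - θ ^ 2 * N / 2) := by
    ext ω
    by_cases hω : τ ω < N
    · have hap := apply_cappedPassageTime (hW.continuous ω) hx (hW.zero ω) hω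
      rw [← hτdef] at hap
      rw [Set.indicator_of_mem (by exact hω)]
      simp only [Φ, G]
      rw [Set.indicator_of_mem (by exact hω), ← Complex.exp_add, hVdef, restart,
        add_tsub_cancel_of_le hω.le, ← hap, ← hθ, NNReal.coe_sub hω.le]
      congr 1
      push_cast
      ring
    · rw [Set.indicator_of_notMem (by exact hω)]
      simp only [Φ, G]
      rw [Set.indicator_of_notMem (by exact hω), zero_mul]
  have hint : Integrable (fun ω ↦ Φ (τ ω) ω) P := by
    rw [hsplit]
    exact (integrable_cexp_martingale hW θ N).indicator hA
  have key := integral_eq_integral_integral_of_indepFun_process hτm hV.measurable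
    (indepFun_restart hW hτ) hΦm hint
  rw [hsplit, integral_indicator hA] at key
  rw [key, ← integral_indicator hA]
  congr 1
  ext ω
  simp only [Φ]
  rw [integral_const_mul, integral_cexp_martingale hV, mul_one]
  rfl

/-- Until time `N` the optional stopping identity for the exponential martingale fails only by an
exponentially small term: on the event that the level is not passed, the martingale is bounded by
`exp (Re θ x - Re ζ N)`. -/
lemma norm_one_sub_setIntegral_le [IsProbabilityMeasure P] (hW : IsRegularBM W P) (hx : 0 ≤ x)
    {θ : ℂ} (hθ : θ ^ 2 / 2 + c * θ = ζ) (hθ0 : 0 ≤ θ.re) (N : ℝ≥0) :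
    ‖1 - ∫ ω in {ω | cappedPassageTime c W x N ω < N},
        cexp (θ * x - ζ * cappedPassageTime c W x N ω) ∂P‖ ≤
      Real.exp (θ.re * x - ζ.re * N) := by
  have hτ : IsOptionalTime W (cappedPassageTime c W x N) :=
    isOptionalTime_cappedPassageTime hW.continuous
  have hA : MeasurableSet {ω | cappedPassageTime c W x N ω < N} :=
    measurableSet_lt (hτ.measurable hW.measurable) measurable_const
  rw [← setIntegral_cexp_martingale hW hx hθ, ← integral_cexp_martingale hW θ N,
    ← integral_add_compl hA (integrable_cexp_martingale hW θ N), add_sub_cancel_left]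
  refine (norm_setIntegral_le_of_norm_le_const (C := Real.exp (θ.re * x - ζ.re * N))
    (measure_lt_top _ _) fun ω hω ↦ ?_).trans ?_
  · have hN : N ≤ cappedPassageTime c W x N ω := not_lt.1 hω
    have hle := le_of_le_cappedPassageTime (hW.continuous ω) hx (hW.zero ω) hN
    have e : θ * W N ω - θ ^ 2 * N / 2 = θ * ((c * N + W N ω : ℝ) : ℂ) - ζ * ((N : ℝ) : ℂ) := by
      rw [← hθ]
      push_cast
      ring
    rw [norm_exp, e, sub_re, re_mul_ofReal, re_mul_ofReal]
    gcongr
  · exact mul_le_of_le_one_right (Real.exp_pos _).le measureReal_le_one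

/-- The paths of a Brownian motion with nonnegative drift exceed every level. -/
lemma ae_exists_lt [IsProbabilityMeasure P] (hW : IsRegularBM W P) (hc : 0 ≤ c) :
    ∀ᵐ ω ∂P, ∀ x : ℝ, ∃ r : ℝ≥0, x < c * r + W r ω := by
  suffices h : ∀ n : ℕ, ∀ᵐ ω ∂P, ∃ r : ℝ≥0, n < c * r + W r ω by
    filter_upwards [ae_all_iff.2 h] with ω hω x
    obtain ⟨n, hn⟩ := exists_nat_ge x
    obtain ⟨r, hr⟩ := hω n
    exact ⟨r, hn.trans_lt hr⟩
  intro n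
  set E : Set Ω := {ω | ∃ r : ℝ≥0, n < c * r + W r ω} with hE
  have hEm : MeasurableSet E := by
    have : E = ⋃ k : ℕ, {ω | ∃ r < (k : ℝ≥0), n < c * r + W r ω} := by
      ext ω
      simp only [hE, Set.mem_ofPred_eq, Set.mem_iUnion]
      exact ⟨fun ⟨r, hr⟩ ↦ (exists_nat_gt r).imp fun k hk ↦ ⟨r, hk, hr⟩,
        fun ⟨k, r, _, hr⟩ ↦ ⟨r, hr⟩⟩
    rw [this]
    exact MeasurableSet.iUnion fun k ↦
      measurableSet_exists_lt (fun r _ ↦ hW.measurable r) hW.continuous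
  -- The real frequencies `1 / (k + 1)` tend to `0`, where the exponent vanishes.
  have hbound : ∀ (k : ℕ) (N : ℝ≥0),
      1 - Real.exp ((laplaceExponent c (0 + 1 / ((k : ℂ) + 1))).re * n - 1 / ((k : ℝ) + 1) * N) ≤
        Real.exp ((laplaceExponent c (0 + 1 / ((k : ℂ) + 1))).re * n) * P.real E := by
    intro k N
    set ζ : ℂ := 0 + 1 / ((k : ℂ) + 1) with hζ
    have hζr : ζ = ((1 / ((k : ℝ) + 1) : ℝ) : ℂ) := by
      rw [hζ]; push_cast; ring
    have hζre : ζ.re = 1 / ((k : ℝ) + 1) := by rw [hζr, ofReal_re]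
    have hζ0 : 0 ≤ ζ.re := by rw [hζre]; positivity
    have h1 := norm_one_sub_setIntegral_le hW n.cast_nonneg (laplaceExponent_spec c ζ)
      (laplaceExponent_re_nonneg hζ0) N
    have h2 : ‖∫ ω in {ω | cappedPassageTime c W n N ω < N},
        cexp (laplaceExponent c ζ * (n : ℝ) - ζ * cappedPassageTime c W n N ω) ∂P‖ ≤
        Real.exp ((laplaceExponent c ζ).re * n) *
          P.real {ω | cappedPassageTime c W n N ω < N} := by
      refine norm_setIntegral_le_of_norm_le_const (measure_lt_top _ _) fun ω _ ↦ ?_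
      rw [norm_exp, sub_re, re_mul_ofReal, re_mul_ofReal]
      gcongr
      have : 0 ≤ ζ.re * (cappedPassageTime c W n N ω : ℝ) := by positivity
      linarith
    have h3 : P.real {ω | cappedPassageTime c W n N ω < N} ≤ P.real E := by
      refine measureReal_mono fun ω hω ↦ ?_
      rcases cappedPassageTime_lt_iff.1 hω with h | ⟨r, -, hr⟩
      · exact absurd h (lt_irrefl _)
      · exact ⟨r, hr⟩
    have h4 := norm_sub_norm_le (1 : ℂ) (∫ ω in {ω | cappedPassageTime c W n N ω < N},
        cexp (laplaceExponent c ζ * (n : ℝ) - ζ * cappedPassageTime c W n N ω) ∂P)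
    rw [norm_one] at h4
    rw [hζre] at h1
    have h5 := mul_le_mul_of_nonneg_left h3 (Real.exp_pos ((laplaceExponent c ζ).re * n)).le
    linarith
  have hboundN : ∀ k : ℕ,
      1 ≤ Real.exp ((laplaceExponent c (0 + 1 / ((k : ℂ) + 1))).re * n) * P.real E := by
    intro k
    have hlim : Tendsto (fun N : ℕ ↦
        1 - Real.exp ((laplaceExponent c (0 + 1 / ((k : ℂ) + 1))).re * n -
          1 / ((k : ℝ) + 1) * ((N : ℝ≥0) : ℝ))) atTop (𝓝 (1 - 0)) := by
      refine tendsto_const_nhds.sub (Real.tendsto_exp_atBot.comp ?_)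
      refine tendsto_atBot_add_const_left _ _ (tendsto_neg_atTop_atBot.comp ?_)
      exact tendsto_natCast_atTop_atTop.const_mul_atTop (by positivity)
    rw [sub_zero] at hlim
    exact le_of_tendsto' hlim fun N ↦ hbound k N
  have hPE : 1 ≤ P.real E := by
    have hlim : Tendsto (fun k : ℕ ↦
        Real.exp ((laplaceExponent c (0 + 1 / ((k : ℂ) + 1))).re * n) * P.real E) atTop
        (𝓝 (Real.exp ((laplaceExponent c 0).re * n) * P.real E)) := by
      have h := tendsto_laplaceExponent_add (c := c) (ζ := 0) le_rfl
      have h' := (continuous_re.tendsto _).comp h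
      exact ((Real.continuous_exp.tendsto _).comp (h'.mul_const _)).mul_const _
    rw [laplaceExponent_zero hc] at hlim
    simpa using ge_of_tendsto' hlim hboundN
  have : P E = 1 := by
    have h1 : P.real E = 1 := le_antisymm measureReal_le_one hPE
    exact (ENNReal.toReal_eq_one_iff _).1 h1
  exact (prob_compl_eq_zero_iff hEm).2 this

/-- The Laplace transform of the passage times, for frequencies in the closed right half-plane. -/
lemma integral_cexp_passageTime [IsProbabilityMeasure P] (hW : IsRegularBM W P)
    (hpass : ∀ ω, ∀ x : ℝ, ∃ r : ℝ≥0, x < c * r + W r ω) (hx : 0 ≤ x)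
    (hζ : 0 ≤ ζ.re) :
    ∫ ω, cexp (-ζ * passageTime c W x ω) ∂P = cexp (-laplaceExponent c ζ * x) := by
  have hTm : Measurable (passageTime c W x) :=
    measurable_passageTime hW.measurable hW.continuous fun ω ↦ hpass ω x
  have hnorm : ∀ ζ : ℂ, 0 ≤ ζ.re → ∀ s : ℝ≥0, ‖cexp (-ζ * s)‖ ≤ 1 := by
    intro ζ hζ s
    rw [norm_exp, re_mul_ofReal, neg_re, Real.exp_le_one_iff]
    have : 0 ≤ ζ.re * (s : ℝ) := by positivity
    linarith
  have hpos : ∀ ζ : ℂ, 0 < ζ.re →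
      ∫ ω, cexp (-ζ * passageTime c W x ω) ∂P = cexp (-laplaceExponent c ζ * x) := by
    intro ζ hζ
    set θ := laplaceExponent c ζ
    have hlim1 : Tendsto (fun N : ℕ ↦ ∫ ω in {ω | cappedPassageTime c W x N ω < (N : ℝ≥0)},
        cexp (θ * x - ζ * cappedPassageTime c W x N ω) ∂P) atTop (𝓝 1) := by
      have hb : Tendsto (fun N : ℕ ↦ Real.exp (θ.re * x - ζ.re * ((N : ℝ≥0) : ℝ))) atTop
          (𝓝 0) := by
        refine Real.tendsto_exp_atBot.comp ?_
        refine tendsto_atBot_add_const_left _ _ (tendsto_neg_atTop_atBot.comp ?_)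
        exact tendsto_natCast_atTop_atTop.const_mul_atTop hζ
      have h0 := squeeze_zero_norm (fun N : ℕ ↦ norm_one_sub_setIntegral_le hW hx
        (laplaceExponent_spec c ζ) (laplaceExponent_re_nonneg hζ.le) N) hb
      simpa using tendsto_const_nhds (x := (1 : ℂ)).sub h0
    have hlim2 : Tendsto (fun N : ℕ ↦ ∫ ω in {ω | cappedPassageTime c W x N ω < (N : ℝ≥0)},
        cexp (θ * x - ζ * cappedPassageTime c W x N ω) ∂P) atTop
        (𝓝 (∫ ω, cexp (θ * x - ζ * passageTime c W x ω) ∂P)) := by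
      have hm : ∀ N : ℕ, Measurable (cappedPassageTime c W x N) := fun N ↦
        (isOptionalTime_cappedPassageTime hW.continuous).measurable hW.measurable
      have hmA : ∀ N : ℕ, MeasurableSet {ω | cappedPassageTime c W x N ω < (N : ℝ≥0)} := fun N ↦
        measurableSet_lt (hm N) measurable_const
      simp_rw [← integral_indicator (hmA _)]
      refine tendsto_integral_of_dominated_convergence (fun _ ↦ ‖cexp (θ * x)‖) (fun N ↦ ?_)
        (integrable_const _) (fun N ↦ ae_of_all _ fun ω ↦ ?_) (ae_of_all _ fun ω ↦ ?_)
      · have := hm N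
        exact (Measurable.indicator (by fun_prop) (hmA N)).aestronglyMeasurable
      · refine (norm_indicator_le_norm_self _ _).trans ?_
        rw [sub_eq_add_neg, ← neg_mul, Complex.exp_add, norm_mul]
        exact mul_le_of_le_one_right (norm_nonneg _) (hnorm ζ hζ.le _)
      · refine tendsto_const_nhds.congr' ?_
        obtain ⟨M, hM⟩ := exists_nat_gt (passageTime c W x ω)
        filter_upwards [eventually_ge_atTop M] with N hN
        have hN' : passageTime c W x ω < N := hM.trans_le (by exact_mod_cast hN)
        have e := cappedPassageTime_eq_passageTime (hpass ω x) hN'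
        rw [Set.indicator_of_mem, e]
        change cappedPassageTime c W x N ω < N
        rwa [e]
    have h := tendsto_nhds_unique hlim2 hlim1
    simp_rw [sub_eq_add_neg, Complex.exp_add, ← neg_mul, integral_const_mul] at h
    rw [neg_mul, Complex.exp_neg]
    exact eq_inv_of_mul_eq_one_right h
  have happrox : ∀ n : ℕ, 0 < (ζ + 1 / ((n : ℂ) + 1)).re := by
    intro n
    have : ζ + 1 / ((n : ℂ) + 1) = ζ + ((1 / ((n : ℝ) + 1) : ℝ) : ℂ) := by push_cast; rfl
    rw [this, add_re, ofReal_re]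
    positivity
  have hlim1 : Tendsto (fun n : ℕ ↦ ∫ ω, cexp (-(ζ + 1 / ((n : ℂ) + 1)) * passageTime c W x ω) ∂P)
      atTop (𝓝 (∫ ω, cexp (-ζ * passageTime c W x ω) ∂P)) := by
    refine tendsto_integral_of_dominated_convergence (fun _ ↦ 1) (fun n ↦ ?_)
      (integrable_const _) (fun n ↦ ae_of_all _ fun ω ↦ hnorm _ (happrox n).le _)
      (ae_of_all _ fun ω ↦ ?_)
    · exact Measurable.aestronglyMeasurable (by fun_prop)
    · refine (Complex.continuous_exp.tendsto _).comp (Tendsto.mul_const _ (Tendsto.neg ?_))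
      simpa using tendsto_const_nhds.add (tendsto_one_div_add_atTop_nhds_zero_nat (𝕜 := ℂ))
  refine tendsto_nhds_unique hlim1 ?_
  simp_rw [fun n ↦ hpos _ (happrox n)]
  exact (Complex.continuous_exp.tendsto _).comp ((tendsto_laplaceExponent_add hζ).neg.mul_const _)

end Laplace

/-! ### Increments of the passage times -/

section Increments

open Complex

variable {W : ℝ≥0 → Ω → ℝ} {c x : ℝ}

lemma exists_lt_restart (hW : IsRegularBM W P)
    (hpass : ∀ ω, ∀ x : ℝ, ∃ r : ℝ≥0, x < c * r + W r ω) (hx : 0 ≤ x) (ω : Ω) (y : ℝ) :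
    ∃ r : ℝ≥0, y < c * r + restart W (passageTime c W x) r ω := by
  obtain ⟨r, hr⟩ := hpass ω (max x (x + y))
  have hap := apply_passageTime (hW.continuous ω) hx (hW.zero ω) (hpass ω x)
  have hTr : passageTime c W x ω ≤ r := by
    by_contra! hlt
    have := le_of_le_passageTime (hW.continuous ω) hx (hW.zero ω) (hpass ω x) hlt.le
    exact absurd ((le_max_left _ _).trans_lt hr) this.not_gt
  refine ⟨r - passageTime c W x ω, ?_⟩
  rw [restart, add_tsub_cancel_of_le hTr, NNReal.coe_sub hTr]
  linarith [(le_max_right x (x + y)).trans_lt hr]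

/-- The Laplace transform at frequency one, in real form. -/
lemma integral_exp_neg_passageTime [IsProbabilityMeasure P] (hW : IsRegularBM W P)
    (hpass : ∀ ω, ∀ x : ℝ, ∃ r : ℝ≥0, x < c * r + W r ω) (hx : 0 ≤ x) :
    ∫ ω, Real.exp (-passageTime c W x ω) ∂P = (cexp (-laplaceExponent c 1 * x)).re := by
  rw [← integral_cexp_passageTime hW hpass hx (ζ := 1) (by simp), ← ofReal_re (∫ ω, _ ∂P),
    ← integral_complex_ofReal]
  congr 2
  ext ω
  push_cast
  simp

lemma integrable_exp_neg [IsProbabilityMeasure P] {T : Ω → ℝ≥0} (hT : Measurable T) :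
    Integrable (fun ω ↦ Real.exp (-T ω)) P := by
  refine Integrable.of_bound (by fun_prop) 1 (ae_of_all _ fun ω ↦ ?_)
  rw [Real.norm_eq_abs, Real.abs_exp, Real.exp_le_one_iff]
  simp

lemma passageTime_zero_ae [IsProbabilityMeasure P] (hW : IsRegularBM W P)
    (hpass : ∀ ω, ∀ x : ℝ, ∃ r : ℝ≥0, x < c * r + W r ω) :
    ∀ᵐ ω ∂P, passageTime c W 0 ω = 0 := by
  have hT : Measurable (passageTime c W 0) :=
    measurable_passageTime hW.measurable hW.continuous fun ω ↦ hpass ω 0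
  have h := integral_exp_neg_passageTime hW hpass le_rfl
  have h0 : ∫ ω, (1 - Real.exp (-passageTime c W 0 ω)) ∂P = 0 := by
    rw [integral_sub (integrable_const _) (integrable_exp_neg hT), h]
    simp
  rw [integral_eq_zero_iff_of_nonneg] at h0
  · filter_upwards [h0] with ω hω
    have h1 : Real.exp (-passageTime c W 0 ω) = 1 := by
      simp only [Pi.zero_apply] at hω
      linarith
    simpa using h1
  · intro ω
    simp
  · exact (integrable_const _).sub (integrable_exp_neg hT)

/-- The first time at or above a fixed level almost surely agrees with the first time above it:
the Laplace transform shows that the passage times have no jump at a fixed level. -/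
lemma passageTime_eq_sInf_ae [IsProbabilityMeasure P] (hW : IsRegularBM W P)
    (hpass : ∀ ω, ∀ x : ℝ, ∃ r : ℝ≥0, x < c * r + W r ω) (hx : 0 ≤ x) :
    ∀ᵐ ω ∂P, sInf {s : ℝ≥0 | x ≤ c * s + W s ω} = passageTime c W x ω := by
  rcases hx.eq_or_lt with rfl | hx
  · filter_upwards [passageTime_zero_ae hW hpass] with ω hω
    rw [hω]
    refine le_antisymm (csInf_le (OrderBot.bddBelow _) ?_) zero_le
    simp [hW.zero ω]
  set y : ℕ → ℝ := fun n ↦ x - x * (1 / ((n : ℝ) + 1)) with hy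
  have hy0 : ∀ n, 0 ≤ y n := fun n ↦ by
    have : 1 / ((n : ℝ) + 1) ≤ 1 := by
      rw [div_le_one (by positivity)]
      linarith [n.cast_nonneg (α := ℝ)]
    simp only [hy]
    nlinarith
  have hyx : ∀ n, y n < x := fun n ↦ by
    have : 0 < x * (1 / ((n : ℝ) + 1)) := by positivity
    simp only [hy]
    linarith
  have hylim : Tendsto y atTop (𝓝 x) := by
    simpa [hy] using tendsto_const_nhds (x := x).sub
      ((tendsto_one_div_add_atTop_nhds_zero_nat (𝕜 := ℝ)).const_mul x)
  have hT : ∀ z, Measurable (passageTime c W z) := fun z ↦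
    measurable_passageTime hW.measurable hW.continuous fun ω ↦ hpass ω z
  set D : ℕ → Ω → ℝ := fun n ω ↦
    Real.exp (-passageTime c W (y n) ω) - Real.exp (-passageTime c W x ω) with hD
  have hD0 : ∀ n ω, 0 ≤ D n ω := by
    intro n ω
    have h1 : passageTime c W (y n) ω ≤ passageTime c W x ω :=
      passageTime_mono (hpass ω) (hyx n).le
    have h2 : (passageTime c W (y n) ω : ℝ) ≤ passageTime c W x ω := by exact_mod_cast h1
    simp only [hD, sub_nonneg]
    gcongr
  have hDint : Tendsto (fun n ↦ ∫ ω, D n ω ∂P) atTop (𝓝 0) := by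
    simp_rw [hD, fun n ↦ integral_sub (integrable_exp_neg (P := P) (hT (y n)))
      (integrable_exp_neg (P := P) (hT x)), integral_exp_neg_passageTime hW hpass hx.le,
      fun n ↦ integral_exp_neg_passageTime hW hpass (hy0 n)]
    have hcont : Continuous fun z : ℝ ↦ (cexp (-laplaceExponent c 1 * z)).re := by fun_prop
    simpa using ((hcont.tendsto x).comp hylim).sub_const (cexp (-laplaceExponent c 1 * x)).re
  have hinf : ∫⁻ ω, ⨅ n, ENNReal.ofReal (D n ω) ∂P = 0 := by
    refine le_antisymm ?_ zero_le
    refine ge_of_tendsto' (x := atTop) (f := fun n ↦ ENNReal.ofReal (∫ ω, D n ω ∂P)) ?_ fun n ↦ ?_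
    · simpa using ENNReal.tendsto_ofReal hDint
    · have hDi : Integrable (D n) P :=
        (integrable_exp_neg (hT (y n))).sub (integrable_exp_neg (hT x))
      rw [ofReal_integral_eq_lintegral_ofReal hDi (ae_of_all _ (hD0 n))]
      exact lintegral_mono fun ω ↦ iInf_le _ n
  rw [lintegral_eq_zero_iff] at hinf
  · filter_upwards [hinf] with ω hω
    refine le_antisymm (csInf_le_csInf (OrderBot.bddBelow _) (hpass ω x) fun s hs ↦ ?_) ?_
    · exact le_of_lt (show x < c * s + W s ω from hs)
    set S := sInf {s : ℝ≥0 | x ≤ c * s + W s ω}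
    have hS : ∀ n, passageTime c W (y n) ω ≤ S := by
      intro n
      obtain ⟨r, hr⟩ := hpass ω x
      have hne : {s : ℝ≥0 | x ≤ c * s + W s ω}.Nonempty := ⟨r, hr.le⟩
      refine csInf_le_csInf (OrderBot.bddBelow _) hne fun s hs ↦ ?_
      exact (hyx n).trans_le (show x ≤ c * s + W s ω from hs)
    have hle : ENNReal.ofReal (Real.exp (-S) - Real.exp (-passageTime c W x ω)) ≤ 0 := by
      have hω' : ⨅ n, ENNReal.ofReal (D n ω) = 0 := hω
      rw [← hω']
      refine le_iInf fun n ↦ ENNReal.ofReal_le_ofReal ?_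
      have : (passageTime c W (y n) ω : ℝ) ≤ S := by exact_mod_cast hS n
      simp only [hD]
      gcongr
    have h1 := ENNReal.ofReal_eq_zero.1 (le_antisymm hle zero_le)
    have h2 : -(S : ℝ) ≤ -passageTime c W x ω := Real.exp_le_exp.1 (by linarith)
    exact_mod_cast neg_le_neg_iff.1 h2
  · refine Measurable.iInf fun n ↦ ENNReal.measurable_ofReal.comp ?_
    have h1 := hT (y n)
    have h2 := hT x
    fun_prop

/-- The joint Laplace transform of the increments of the passage times factorizes. The proof peels
off the first passage: by the strong Markov property the later increments are passage-time
increments of the restarted Brownian motion, which is independent of the first passage time. -/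
lemma integral_prod_cexp_increments (n : ℕ) [IsProbabilityMeasure P]
    (W : ℝ≥0 → Ω → ℝ) (hW : IsRegularBM W P)
    (hpass : ∀ ω, ∀ x : ℝ, ∃ r : ℝ≥0, x < c * r + W r ω) (x : ℕ → ℝ) (hx : Monotone x)
    (hx0 : 0 ≤ x 0) (ζ : ℕ → ℂ) (hζ : ∀ k, 0 ≤ (ζ k).re) :
    ∫ ω, cexp (-ζ 0 * passageTime c W (x 0) ω) * ∏ k ∈ Finset.range n,
        cexp (-ζ (k + 1) * (passageTime c W (x (k + 1)) ω - passageTime c W (x k) ω)) ∂P =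
      cexp (-laplaceExponent c (ζ 0) * x 0) * ∏ k ∈ Finset.range n,
        cexp (-laplaceExponent c (ζ (k + 1)) * (x (k + 1) - x k)) := by
  induction n generalizing W x ζ with
  | zero => simpa using integral_cexp_passageTime hW hpass hx0 (hζ 0)
  | succ m ih =>
    set τ := passageTime c W (x 0) with hτdef
    have hτ : IsOptionalTime W τ := isOptionalTime_passageTime hW.continuous fun ω ↦ hpass ω _
    have hτm := hτ.measurable hW.measurable
    set V := restart W τ with hVdef
    have hV : IsRegularBM V P := isRegularBM_restart hW hτ
    have hVpass : ∀ ω, ∀ x : ℝ, ∃ r : ℝ≥0, x < c * r + V r ω := exists_lt_restart hW hpass hx0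
    have hadd : ∀ k ω, passageTime c W (x k) ω = τ ω + passageTime c V (x k - x 0) ω := fun k ω ↦
      passageTime_eq_add (hW.continuous ω) hx0 (hx k.zero_le) (hW.zero ω) (hpass ω)
    let Ψ : Ω → ℂ := fun ω ↦ ∏ k ∈ Finset.range (m + 1), cexp (-ζ (k + 1) *
      (passageTime c V (x (k + 1) - x 0) ω - passageTime c V (x k - x 0) ω))
    have hΨ : Measurable[generated V] Ψ := by
      have hT : ∀ y, Measurable[generated V] (passageTime c V y) := fun y ↦
        measurable_passageTime (measurable_generated V) hV.continuous fun ω ↦ hVpass ω y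
      let _ : MeasurableSpace Ω := generated V
      refine Finset.measurable_fun_prod _ fun k _ ↦ ?_
      have h1 := hT (x (k + 1) - x 0)
      have h2 := hT (x k - x 0)
      fun_prop
    have hind : IndepFun (fun ω ↦ cexp (-ζ 0 * τ ω)) Ψ P := by
      have h1 : IndepFun τ Ψ P := indep_of_indep_of_le_right (indepFun_restart hW hτ) hΨ.comap_le
      exact h1.comp (φ := fun s : ℝ≥0 ↦ cexp (-ζ 0 * s)) (by fun_prop) measurable_id
    have hsplit : ∀ ω, cexp (-ζ 0 * τ ω) * ∏ k ∈ Finset.range (m + 1),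
        cexp (-ζ (k + 1) * (passageTime c W (x (k + 1)) ω - passageTime c W (x k) ω)) =
        cexp (-ζ 0 * τ ω) * Ψ ω := by
      intro ω
      congr 1
      refine Finset.prod_congr rfl fun k _ ↦ ?_
      rw [hadd, hadd]
      congr 1
      push_cast
      ring
    simp_rw [hsplit]
    rw [hind.integral_fun_mul_eq_mul_integral (by fun_prop)
      (hΨ.mono (generated_le hV.measurable) le_rfl).aestronglyMeasurable,
      integral_cexp_passageTime hW hpass hx0 (hζ 0)]
    congr 1
    have hΨ0 : ∀ᵐ ω ∂P, Ψ ω = cexp (-ζ 1 * passageTime c V (x 1 - x 0) ω) *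
        ∏ k ∈ Finset.range m, cexp (-ζ (k + 1 + 1) *
          (passageTime c V (x (k + 1 + 1) - x 0) ω - passageTime c V (x (k + 1) - x 0) ω)) := by
      filter_upwards [passageTime_zero_ae hV hVpass] with ω hω
      simp only [Ψ]
      rw [Finset.prod_range_succ', mul_comm]
      simp [hω]
    rw [integral_congr_ae hΨ0]
    have := ih V hV hVpass (fun k ↦ x (k + 1) - x 0)
      (fun i j hij ↦ sub_le_sub_right (hx (by lia)) _) (sub_nonneg.2 (hx (by lia)))
      (fun k ↦ ζ (k + 1)) (fun k ↦ hζ _)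
    simp only [zero_add] at this
    rw [this, Finset.prod_range_succ', mul_comm]
    simp

end Increments

/-! ### The subordinated pair -/

section Pair

open Complex

variable {W W' : ℝ≥0 → Ω → ℝ} {α β δ μ lam : ℝ}

lemma integral_cexp_mul_sub [IsProbabilityMeasure P] (hW : IsRegularBM W P) (z : ℂ) {s t : ℝ≥0}
    (hst : s ≤ t) :
    ∫ ω, cexp (z * (W t ω - W s ω)) ∂P = cexp (z ^ 2 / 2 * (t - s)) := by
  have h := complexMGF_gaussianReal
    ((hW.toIsPreBrownianReal.shift s).hasLaw_eval (t - s)).map_eq z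
  rw [complexMGF] at h
  simp only [add_tsub_cancel_of_le hst, NNReal.coe_sub hst] at h
  push_cast at h
  rw [h]
  congr 1
  ring

lemma integral_prod_cexp_mul_sub [IsProbabilityMeasure P] (hW : IsRegularBM W P) (z : ℕ → ℂ)
    {s : ℕ → ℝ≥0} (hs : Monotone s) (n : ℕ) :
    ∫ ω, ∏ k ∈ Finset.range n, cexp (z k * (W (s (k + 1)) ω - W (s k) ω)) ∂P =
      ∏ k ∈ Finset.range n, cexp (z k ^ 2 / 2 * (s (k + 1) - s k)) := by
  have hind := hW.toIsPreBrownianReal.hasIndepIncrements n (fun i ↦ s i)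
    (fun i j hij ↦ hs hij)
  have hind' := hind.comp (fun (i : Fin n) (r : ℝ) ↦ cexp (z i * r)) (fun i ↦ by fun_prop)
  simp_rw [Finset.prod_range]
  have hm := hW.measurable
  have h := hind'.integral_fun_prod_eq_prod_integral fun i ↦ by
    refine Measurable.aestronglyMeasurable (Measurable.comp (by fun_prop) ?_)
    exact (hm _).sub (hm _)
  simp only [Function.comp_apply, Fin.val_succ, Fin.val_castSucc, ofReal_sub] at h
  rw [h]
  exact Finset.prod_congr rfl fun i _ ↦ integral_cexp_mul_sub hW _ (hs (Nat.le_succ _))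

/-- The exponent is the drift term minus `δ` times the Laplace exponent of the passage times. -/
lemma exponent_eq (hαβ : |β| ≤ α) (u v : ℝ) :
    exponent α β δ μ lam u v = I * μ * u -
      δ * laplaceExponent √(α ^ 2 - β ^ 2) ((u : ℂ) ^ 2 / 2 - I * u * β - I * v * lam) := by
  have h : (√(α ^ 2 - β ^ 2) : ℂ) ^ 2 = (α : ℂ) ^ 2 - (β : ℂ) ^ 2 := by
    have : √(α ^ 2 - β ^ 2) ^ 2 = α ^ 2 - β ^ 2 :=
      Real.sq_sqrt (sub_nonneg.2 (sq_le_sq.2 (hαβ.trans (le_abs_self α))))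
    exact_mod_cast congrArg (fun r : ℝ ↦ (r : ℂ)) this
  have e : (α : ℂ) ^ 2 - 2 * I * lam * v - ((β : ℂ) + I * u) ^ 2 =
      (√(α ^ 2 - β ^ 2) : ℂ) ^ 2 + 2 * ((u : ℂ) ^ 2 / 2 - I * u * β - I * v * lam) := by
    rw [h]
    linear_combination -(u : ℂ) ^ 2 * I_sq
  rw [exponent, laplaceExponent, e]
  ring

lemma re_frequency (u v β lam : ℝ) :
    ((u : ℂ) ^ 2 / 2 - I * u * β - I * v * lam).re = u ^ 2 / 2 := by
  have : (u : ℂ) ^ 2 / 2 - I * u * β - I * v * lam =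
      ((u ^ 2 / 2 : ℝ) : ℂ) + ((-(u * β + v * lam) : ℝ) : ℂ) * I := by
    push_cast
    ring
  rw [this, add_re, ofReal_re, re_ofReal_mul, I_re, mul_zero, add_zero]

lemma continuous_exponent (hαβ : |β| ≤ α) :
    Continuous fun p : ℝ × ℝ ↦ exponent α β δ μ lam p.1 p.2 := by
  simp_rw [exponent_eq hαβ]
  refine Continuous.sub (by fun_prop) (continuous_const.mul ?_)
  refine continuous_iff_continuousAt.2 fun p ↦ ContinuousAt.comp (g := laplaceExponent _)
    (f := fun p : ℝ × ℝ ↦ (p.1 : ℂ) ^ 2 / 2 - I * p.1 * β - I * p.2 * lam) ?_ (by fun_prop)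
  refine continuousAt_laplaceExponent ?_
  rw [re_frequency]
  positivity

lemma exponent_zero (hαβ : |β| ≤ α) : exponent α β δ μ lam 0 0 = 0 := by
  simp [exponent_eq hαβ, laplaceExponent_zero]

/-- The pair `(Z_t, λ Λ_t)`, with the passage time strictly above the level `δ t` as `Λ_t`, so that
its paths are right-continuous. -/
noncomputable def levyPair (α β δ μ lam : ℝ) (W W' : ℝ≥0 → Ω → ℝ) (t : ℝ≥0) (ω : Ω) : ℝ × ℝ :=
  (μ * t + β * passageTime √(α ^ 2 - β ^ 2) W (δ * t) ω +
      W' (passageTime √(α ^ 2 - β ^ 2) W (δ * t) ω) ω,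
    lam * passageTime √(α ^ 2 - β ^ 2) W (δ * t) ω)

lemma measurable_levyPair (hW : IsRegularBM W P) (hW' : IsRegularBM W' P)
    (hpass : ∀ ω, ∀ x : ℝ, ∃ r : ℝ≥0, x < √(α ^ 2 - β ^ 2) * r + W r ω) (t : ℝ≥0) :
    Measurable (levyPair α β δ μ lam W W' t) := by
  have hT := measurable_passageTime hW.measurable hW.continuous fun ω ↦ hpass ω (δ * t)
  have hu : Measurable (Function.uncurry W') :=
    measurable_uncurry_of_continuous_of_measurable hW'.continuous hW'.measurable
  have h1 := hu.comp (hT.prodMk measurable_id)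
  refine Measurable.prodMk (Measurable.add (by fun_prop) h1) (by fun_prop)

/-- The joint characteristic function of the increments of the pair. Freezing the passage times
turns the increments of `W'` into Gaussian factors, which leaves a joint Laplace transform of the
increments of the passage times. -/
lemma integral_prod_cexp_levyPair [IsProbabilityMeasure P] (hαβ : |β| ≤ α) (hδ : 0 < δ)
    (hW : IsRegularBM W P) (hW' : IsRegularBM W' P)
    (hind : IndepFun (fun ω t ↦ W t ω) (fun ω t ↦ W' t ω) P)
    (hpass : ∀ ω, ∀ x : ℝ, ∃ r : ℝ≥0, x < √(α ^ 2 - β ^ 2) * r + W r ω)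
    {t : ℕ → ℝ≥0} (ht : Monotone t) (u v : ℕ → ℝ) (n : ℕ) :
    ∫ ω, ∏ k ∈ Finset.range n, cexp (I * u k *
          ((levyPair α β δ μ lam W W' (t (k + 1)) ω).1 - (levyPair α β δ μ lam W W' (t k) ω).1) +
        I * v k *
          ((levyPair α β δ μ lam W W' (t (k + 1)) ω).2 -
            (levyPair α β δ μ lam W W' (t k) ω).2)) ∂P =
      ∏ k ∈ Finset.range n, cexp (exponent α β δ μ lam (u k) (v k) * (t (k + 1) - t k)) := by
  set c := √(α ^ 2 - β ^ 2) with hcdef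
  set T : ℕ → Ω → ℝ≥0 := fun k ↦ passageTime c W (δ * t k) with hTdef
  set ζ : ℕ → ℂ := fun k ↦ (u k : ℂ) ^ 2 / 2 - I * u k * β - I * v k * lam with hζdef
  have hζ : ∀ k, 0 ≤ (ζ k).re := fun k ↦ by
    rw [hζdef, re_frequency]
    positivity
  have hx : Monotone fun k ↦ δ * (t k : ℝ) := fun i j hij ↦ by
    have : (t i : ℝ) ≤ t j := by exact_mod_cast ht hij
    simp only
    gcongr
  have hTmono : ∀ ω, Monotone fun k ↦ T k ω := fun ω i j hij ↦
    passageTime_mono (hpass ω) (hx hij)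
  have hTgen : ∀ k, Measurable[generated W] (T k) := fun k ↦
    measurable_passageTime (measurable_generated W) hW.continuous fun ω ↦ hpass ω _
  have hTm : ∀ k, Measurable (T k) := fun k ↦ (hTgen k).mono (generated_le hW.measurable) le_rfl
  let Y : Ω → ℕ → ℝ≥0 := fun ω k ↦ T k ω
  have hYgen : Measurable[generated W] Y := @measurable_pi_lambda _ _ _ (generated W) _ _ hTgen
  have hYm : Measurable Y := measurable_pi_lambda _ hTm
  have hYind : IndepFun Y (fun ω s ↦ W' s ω) P := indep_of_indep_of_le_left hind hYgen.comap_le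
  let A : (ℕ → ℝ≥0) → ℂ := fun s ↦ ∏ k ∈ Finset.range n,
    cexp (I * u k * (μ * (t (k + 1) - t k) + β * (s (k + 1) - s k)) +
      I * v k * (lam * (s (k + 1) - s k)))
  let Φ : (ℕ → ℝ≥0) → Ω → ℂ := fun s ω ↦
    A s * ∏ k ∈ Finset.range n, cexp (I * u k * (W' (s (k + 1)) ω - W' (s k) ω))
  have hsplit : ∀ ω, ∏ k ∈ Finset.range n, cexp (I * u k *
          ((levyPair α β δ μ lam W W' (t (k + 1)) ω).1 - (levyPair α β δ μ lam W W' (t k) ω).1) +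
        I * v k *
          ((levyPair α β δ μ lam W W' (t (k + 1)) ω).2 -
            (levyPair α β δ μ lam W W' (t k) ω).2)) = Φ (Y ω) ω := by
    intro ω
    simp only [Φ, A]
    rw [← Finset.prod_mul_distrib]
    refine Finset.prod_congr rfl fun k _ ↦ ?_
    rw [← Complex.exp_add]
    congr 1
    simp only [levyPair, Y, hTdef]
    push_cast
    ring
  have hΦm : Measurable[Prod.instMeasurableSpace (m₂ := generated W')] (Function.uncurry Φ) := by
    let _ : MeasurableSpace Ω := generated W'
    have hu : Measurable (Function.uncurry W') :=
      measurable_uncurry_of_continuous_of_measurable hW'.continuous (measurable_generated W')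
    have hk : ∀ k, Measurable fun p : (ℕ → ℝ≥0) × Ω ↦ W' (p.1 k) p.2 := fun k ↦ by
      have h : Measurable fun p : (ℕ → ℝ≥0) × Ω ↦ p.1 k :=
        (measurable_pi_apply k).comp measurable_fst
      exact hu.comp (h.prodMk measurable_snd)
    change Measurable fun p : (ℕ → ℝ≥0) × Ω ↦ A p.1 *
      ∏ k ∈ Finset.range n, cexp (I * u k * (W' (p.1 (k + 1)) p.2 - W' (p.1 k) p.2))
    have hA : Measurable A := Finset.measurable_fun_prod _ fun k _ ↦ by fun_prop
    refine Measurable.mul (hA.comp measurable_fst) (Finset.measurable_fun_prod _ fun k _ ↦ ?_)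
    have h1 := hk k
    have h2 := hk (k + 1)
    fun_prop
  have hnorm : ∀ ω, ‖Φ (Y ω) ω‖ ≤ 1 := by
    intro ω
    rw [← hsplit, norm_prod]
    refine (Finset.prod_eq_one fun k _ ↦ ?_).le
    rw [norm_exp]
    simp
  have hint : Integrable (fun ω ↦ Φ (Y ω) ω) P := by
    refine Integrable.of_bound ?_ 1 (ae_of_all _ hnorm)
    have hΦm' : Measurable (Function.uncurry Φ) :=
      hΦm.mono (sup_le_sup le_rfl (MeasurableSpace.comap_mono (generated_le hW'.measurable))) le_rfl
    exact (hΦm'.comp (hYm.prodMk measurable_id)).aestronglyMeasurable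
  simp_rw [hsplit]
  rw [integral_eq_integral_integral_of_indepFun_process hYm hW'.measurable hYind hΦm hint]
  have hinner : ∀ ω, ∫ ω', Φ (Y ω) ω' ∂P = (∏ k ∈ Finset.range n,
      cexp (I * u k * μ * (t (k + 1) - t k))) *
      ∏ k ∈ Finset.range n, cexp (-ζ k * (T (k + 1) ω - T k ω)) := by
    intro ω
    simp only [Φ]
    rw [integral_const_mul, integral_prod_cexp_mul_sub hW' _ (hTmono ω), ← Finset.prod_mul_distrib,
      ← Finset.prod_mul_distrib]
    refine Finset.prod_congr rfl fun k _ ↦ ?_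
    rw [← Complex.exp_add, ← Complex.exp_add]
    congr 1
    simp only [Y, hζdef]
    linear_combination ((u k : ℂ) ^ 2 / 2 * (T (k + 1) ω - T k ω)) * I_sq
  simp_rw [hinner]
  rw [integral_const_mul]
  -- Frequency `0`, hence no factor, is attached to the first passage time itself.
  obtain ⟨ζ', hζ'0, hζ'⟩ : ∃ ζ' : ℕ → ℂ, ζ' 0 = 0 ∧ ∀ k, ζ' (k + 1) = ζ k :=
    ⟨fun k ↦ Nat.casesOn k 0 ζ, rfl, fun _ ↦ rfl⟩
  have key := integral_prod_cexp_increments n (c := c) W hW hpass (fun k ↦ δ * (t k : ℝ)) hx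
    (by positivity) ζ' (fun k ↦ by cases k <;> simp [hζ, hζ'0, hζ'])
  simp only [hζ'0, hζ', neg_zero, zero_mul, Complex.exp_zero, one_mul,
    laplaceExponent_zero (c := c) (Real.sqrt_nonneg _)] at key
  rw [key, ← Finset.prod_mul_distrib]
  refine Finset.prod_congr rfl fun k _ ↦ ?_
  rw [← Complex.exp_add, exponent_eq hαβ]
  congr 1
  simp only [hζdef]
  push_cast
  ring

end Pair

/-! ### The Lévy property and infinite divisibility -/

section Levy

open Complex

variable {W W' : ℝ≥0 → Ω → ℝ} {α β δ μ lam : ℝ}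

lemma dual_prod_apply (ℓ : StrongDual ℝ (ℝ × ℝ)) (p : ℝ × ℝ) :
    ℓ p = ℓ (1, 0) * p.1 + ℓ (0, 1) * p.2 := by
  have : p = p.1 • ((1 : ℝ), (0 : ℝ)) + p.2 • ((0 : ℝ), (1 : ℝ)) := by ext <;> simp
  conv_lhs => rw [this, map_add, map_smul, map_smul]
  simp [mul_comm]

lemma charFunDual_levyPair_sub [IsProbabilityMeasure P] (hαβ : |β| ≤ α) (hδ : 0 < δ)
    (hW : IsRegularBM W P) (hW' : IsRegularBM W' P)
    (hind : IndepFun (fun ω t ↦ W t ω) (fun ω t ↦ W' t ω) P)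
    (hpass : ∀ ω, ∀ x : ℝ, ∃ r : ℝ≥0, x < √(α ^ 2 - β ^ 2) * r + W r ω)
    {s t : ℝ≥0} (hst : s ≤ t) (ℓ : StrongDual ℝ (ℝ × ℝ)) :
    charFunDual (P.map fun ω ↦ levyPair α β δ μ lam W W' t ω - levyPair α β δ μ lam W W' s ω) ℓ =
      cexp (exponent α β δ μ lam (ℓ (1, 0)) (ℓ (0, 1)) * (t - s)) := by
  have hm := measurable_levyPair (δ := δ) (μ := μ) (lam := lam) hW hW' hpass
  have ht : Monotone fun k : ℕ ↦ if k = 0 then s else t := by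
    intro i j hij
    by_cases hi : i = 0 <;> by_cases hj : j = 0
    · simp [hi, hj]
    · simp [hi, hj, hst]
    · lia
    · simp [hi, hj]
  have h := integral_prod_cexp_levyPair (μ := μ) (lam := lam) hαβ hδ hW hW' hind hpass ht
    (fun _ ↦ ℓ (1, 0)) (fun _ ↦ ℓ (0, 1)) 1
  simp only [Finset.range_one, Finset.prod_singleton, zero_add, one_ne_zero, if_false,
    if_true] at h
  have hmd : Measurable fun ω ↦
      levyPair α β δ μ lam W W' t ω - levyPair α β δ μ lam W W' s ω := (hm t).sub (hm s)
  rw [charFunDual_apply, integral_map hmd.aemeasurable (by fun_prop), ← h]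
  congr 1
  ext ω
  rw [dual_prod_apply]
  congr 1
  push_cast [Prod.fst_sub, Prod.snd_sub]
  ring

lemma levyPair_zero_ae [IsProbabilityMeasure P] (hW : IsRegularBM W P) (hW' : IsRegularBM W' P)
    (hpass : ∀ ω, ∀ x : ℝ, ∃ r : ℝ≥0, x < √(α ^ 2 - β ^ 2) * r + W r ω) :
    ∀ᵐ ω ∂P, levyPair α β δ μ lam W W' 0 ω = 0 := by
  filter_upwards [passageTime_zero_ae hW hpass] with ω hω
  simp [levyPair, hω, hW'.zero]

lemma charFunDual_levyPair [IsProbabilityMeasure P] (hαβ : |β| ≤ α) (hδ : 0 < δ)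
    (hW : IsRegularBM W P) (hW' : IsRegularBM W' P)
    (hind : IndepFun (fun ω t ↦ W t ω) (fun ω t ↦ W' t ω) P)
    (hpass : ∀ ω, ∀ x : ℝ, ∃ r : ℝ≥0, x < √(α ^ 2 - β ^ 2) * r + W r ω)
    (t : ℝ≥0) (ℓ : StrongDual ℝ (ℝ × ℝ)) :
    charFunDual (P.map (levyPair α β δ μ lam W W' t)) ℓ =
      cexp (exponent α β δ μ lam (ℓ (1, 0)) (ℓ (0, 1)) * t) := by
  have h := charFunDual_levyPair_sub (μ := μ) (lam := lam) hαβ hδ hW hW' hind hpass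
    (zero_le (a := t)) ℓ
  rw [NNReal.coe_zero, ofReal_zero, sub_zero] at h
  rw [← h]
  congr 1
  refine Measure.map_congr ?_
  filter_upwards [levyPair_zero_ae (δ := δ) (μ := μ) (lam := lam) hW hW' hpass] with ω hω
  rw [hω, sub_zero]

lemma jointCharFun_levyPair [IsProbabilityMeasure P] (hαβ : |β| ≤ α) (hδ : 0 < δ)
    (hW : IsRegularBM W P) (hW' : IsRegularBM W' P)
    (hind : IndepFun (fun ω t ↦ W t ω) (fun ω t ↦ W' t ω) P)
    (hpass : ∀ ω, ∀ x : ℝ, ∃ r : ℝ≥0, x < √(α ^ 2 - β ^ 2) * r + W r ω)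
    (t : ℝ≥0) (u v : ℝ) :
    jointCharFun P (fun ω ↦ (levyPair α β δ μ lam W W' t ω).1)
        (fun ω ↦ (levyPair α β δ μ lam W W' t ω).2) u v =
      cexp (exponent α β δ μ lam u v * t) := by
  have hm := measurable_levyPair (δ := δ) (μ := μ) (lam := lam) hW hW' hpass t
  have h := charFunDual_levyPair (μ := μ) (lam := lam) hαβ hδ hW hW' hind hpass t
    (u • ContinuousLinearMap.fst ℝ ℝ ℝ + v • ContinuousLinearMap.snd ℝ ℝ ℝ)
  rw [charFunDual_apply, integral_map hm.aemeasurable (by fun_prop)] at h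
  simp only [add_apply, smul_apply, ContinuousLinearMap.coe_fst',
    ContinuousLinearMap.coe_snd', smul_eq_mul, mul_one, mul_zero, add_zero, zero_add] at h
  rw [← h, jointCharFun]
  congr 1
  ext ω
  congr 1
  push_cast
  ring

/-- The increments are independent because their joint characteristic function is the product of
the individual ones. -/
lemma hasIndepIncrements_levyPair [IsProbabilityMeasure P] (hαβ : |β| ≤ α) (hδ : 0 < δ)
    (hW : IsRegularBM W P) (hW' : IsRegularBM W' P)
    (hind : IndepFun (fun ω t ↦ W t ω) (fun ω t ↦ W' t ω) P)
    (hpass : ∀ ω, ∀ x : ℝ, ∃ r : ℝ≥0, x < √(α ^ 2 - β ^ 2) * r + W r ω) :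
    HasIndepIncrements (levyPair α β δ μ lam W W') P := by
  classical
  have hm := measurable_levyPair (δ := δ) (μ := μ) (lam := lam) hW hW' hpass
  intro n t ht
  have hmi : ∀ i : Fin n, Measurable fun ω ↦
      levyPair α β δ μ lam W W' (t i.succ) ω - levyPair α β δ μ lam W W' (t i.castSucc) ω :=
    fun i ↦ (hm _).sub (hm _)
  refine (iIndepFun_iff_charFunDual_pi fun i ↦ (hmi i).aemeasurable).2 fun ℓ ↦ ?_
  have hrhs : ∀ i : Fin n, _ = _ := fun i ↦ charFunDual_levyPair_sub (μ := μ) (lam := lam)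
    hαβ hδ hW hW' hind hpass (ht i.castSucc_le_succ) (ℓ.comp (.single ℝ (fun _ ↦ ℝ × ℝ) i))
  rw [Finset.prod_congr rfl fun i _ ↦ hrhs i]
  -- The functional and the time points are extended from `Fin n` to `ℕ`.
  let t' : ℕ → ℝ≥0 := fun k ↦ t ⟨min n k, by lia⟩
  have ht' : Monotone t' := fun i j hij ↦ ht (Fin.mk_le_mk.2 (by lia))
  have ht'c : ∀ i : Fin n, t' i = t i.castSucc := fun i ↦ by
    simp only [t']
    congr 1
    ext
    simp [i.2.le]
  have ht's : ∀ i : Fin n, t' (i + 1) = t i.succ := fun i ↦ by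
    simp only [t']
    congr 1
    ext
    simp
  let u : ℕ → ℝ := fun k ↦ if h : k < n then ℓ (Pi.single ⟨k, h⟩ (1, 0)) else 0
  let v : ℕ → ℝ := fun k ↦ if h : k < n then ℓ (Pi.single ⟨k, h⟩ (0, 1)) else 0
  have hu : ∀ i : Fin n, u i = ℓ (Pi.single i (1, 0)) := fun i ↦ by simp [u]
  have hv : ∀ i : Fin n, v i = ℓ (Pi.single i (0, 1)) := fun i ↦ by simp [v]
  have h := integral_prod_cexp_levyPair (μ := μ) (lam := lam) hαβ hδ hW hW' hind hpass ht' u v n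
  simp only [Finset.prod_range, ht'c, ht's, hu, hv] at h
  rw [charFunDual_apply, integral_map (measurable_pi_lambda _ hmi).aemeasurable (by fun_prop)]
  refine Eq.trans ?_ h
  congr 1
  ext ω
  have hsum : ∀ p : Fin n → ℝ × ℝ, ℓ p =
      ∑ i, (ℓ (Pi.single i (1, 0)) * (p i).1 + ℓ (Pi.single i (0, 1)) * (p i).2) := by
    intro p
    conv_lhs => rw [← Finset.univ_sum_single p, map_sum]
    exact Finset.sum_congr rfl fun i _ ↦
      dual_prod_apply (ℓ.comp (.single ℝ (fun _ ↦ ℝ × ℝ) i)) (p i)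
  rw [hsum, ← Complex.exp_sum]
  congr 1
  push_cast
  rw [Finset.sum_mul]
  refine Finset.sum_congr rfl fun i _ ↦ ?_
  push_cast [Prod.fst_sub, Prod.snd_sub]
  ring

lemma identDistrib_levyPair_sub [IsProbabilityMeasure P] (hαβ : |β| ≤ α) (hδ : 0 < δ)
    (hW : IsRegularBM W P) (hW' : IsRegularBM W' P)
    (hind : IndepFun (fun ω t ↦ W t ω) (fun ω t ↦ W' t ω) P)
    (hpass : ∀ ω, ∀ x : ℝ, ∃ r : ℝ≥0, x < √(α ^ 2 - β ^ 2) * r + W r ω) (s h : ℝ≥0) :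
    IdentDistrib
      (fun ω ↦ levyPair α β δ μ lam W W' (s + h) ω - levyPair α β δ μ lam W W' s ω)
      (fun ω ↦ levyPair α β δ μ lam W W' h ω - levyPair α β δ μ lam W W' 0 ω) P P := by
  have hm := measurable_levyPair (δ := δ) (μ := μ) (lam := lam) hW hW' hpass
  have hm1 := (hm (s + h)).sub (hm s)
  have hm2 := (hm h).sub (hm 0)
  refine ⟨hm1.aemeasurable, hm2.aemeasurable, ?_⟩
  have := Measure.isProbabilityMeasure_map (μ := P) hm1.aemeasurable
  have := Measure.isProbabilityMeasure_map (μ := P) hm2.aemeasurable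
  refine Measure.ext_of_charFunDual (funext fun ℓ ↦ ?_)
  have h1 := charFunDual_levyPair_sub (μ := μ) (lam := lam) hαβ hδ hW hW' hind hpass
    (le_add_of_nonneg_right (zero_le (a := h)) : s ≤ s + h) ℓ
  have h2 := charFunDual_levyPair_sub (μ := μ) (lam := lam) hαβ hδ hW hW' hind hpass
    (zero_le (a := h)) ℓ
  refine h1.trans (Eq.trans ?_ h2.symm)
  congr 2
  push_cast
  ring

lemma isProcess_levyPair [IsProbabilityMeasure P] (hαβ : |β| ≤ α) (hδ : 0 < δ)
    (hW : IsRegularBM W P) (hW' : IsRegularBM W' P)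
    (hind : IndepFun (fun ω t ↦ W t ω) (fun ω t ↦ W' t ω) P)
    (hpass : ∀ ω, ∀ x : ℝ, ∃ r : ℝ≥0, x < √(α ^ 2 - β ^ 2) * r + W r ω) :
    IsProcess α β δ μ lam (levyPair α β δ μ lam W W') P where
  measurable := measurable_levyPair hW hW' hpass
  zero := levyPair_zero_ae hW hW' hpass
  indepIncrements := hasIndepIncrements_levyPair hαβ hδ hW hW' hind hpass
  stationary := identDistrib_levyPair_sub hαβ hδ hW hW' hind hpass
  rightContinuous ω t := by
    have hT : ContinuousWithinAt
        (fun s : ℝ≥0 ↦ passageTime √(α ^ 2 - β ^ 2) W (δ * s) ω) (Set.Ici t) t := by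
      refine ContinuousWithinAt.comp (g := fun x ↦ passageTime √(α ^ 2 - β ^ 2) W x ω)
        (f := fun s : ℝ≥0 ↦ δ * (s : ℝ)) (t := Set.Ici (δ * (t : ℝ)))
        (continuousWithinAt_passageTime (hpass ω) _)
        (Continuous.continuousWithinAt (by fun_prop)) fun s hs ↦ ?_
      have : (t : ℝ) ≤ s := by exact_mod_cast hs
      exact mul_le_mul_of_nonneg_left this hδ.le
    have hTr : ContinuousWithinAt
        (fun s : ℝ≥0 ↦ (passageTime √(α ^ 2 - β ^ 2) W (δ * s) ω : ℝ)) (Set.Ici t) t :=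
      NNReal.continuous_coe.continuousAt.comp_continuousWithinAt hT
    have hWT : ContinuousWithinAt
        (fun s : ℝ≥0 ↦ W' (passageTime √(α ^ 2 - β ^ 2) W (δ * s) ω) ω) (Set.Ici t) t :=
      (hW'.continuous ω).continuousAt.comp_continuousWithinAt hT
    refine ContinuousWithinAt.prodMk (ContinuousWithinAt.add (ContinuousWithinAt.add ?_ ?_) hWT) ?_
    · exact Continuous.continuousWithinAt (by fun_prop)
    · exact continuousWithinAt_const.mul hTr
    · exact continuousWithinAt_const.mul hTr
  leftLimits ω t := by
    have hmono : Monotone fun s : ℝ≥0 ↦ passageTime √(α ^ 2 - β ^ 2) W (δ * s) ω := by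
      intro r s hrs
      refine passageTime_mono (hpass ω) ?_
      have : (r : ℝ) ≤ s := by exact_mod_cast hrs
      exact mul_le_mul_of_nonneg_left this hδ.le
    have hT := hmono.tendsto_nhdsLT t
    have hTr := (NNReal.continuous_coe.tendsto _).comp hT
    have hWT := ((hW'.continuous ω).tendsto _).comp hT
    have ht : Tendsto (fun s : ℝ≥0 ↦ μ * (s : ℝ)) (𝓝[<] t) (𝓝 (μ * t)) :=
      (Continuous.tendsto (by fun_prop) t).mono_left nhdsWithin_le_nhds
    exact ⟨_, ((ht.add (hTr.const_mul β)).add hWT).prodMk_nhds (hTr.const_mul lam)⟩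
  charFun_eq t u v := jointCharFun_levyPair hαβ hδ hW hW' hind hpass t u v

/-- The law at time `1` is the `n`-fold convolution of the law at time `1 / n`. -/
lemma isInfinitelyDivisible_levyPair [IsProbabilityMeasure P] (hαβ : |β| ≤ α) (hδ : 0 < δ)
    (hW : IsRegularBM W P) (hW' : IsRegularBM W' P)
    (hind : IndepFun (fun ω t ↦ W t ω) (fun ω t ↦ W' t ω) P)
    (hpass : ∀ ω, ∀ x : ℝ, ∃ r : ℝ≥0, x < √(α ^ 2 - β ^ 2) * r + W r ω) :
    IsInfinitelyDivisible (P.map (levyPair α β δ μ lam W W' 1)) := by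
  have hm := measurable_levyPair (δ := δ) (μ := μ) (lam := lam) hW hW' hpass
  have hprob : ∀ t, IsProbabilityMeasure (P.map (levyPair α β δ μ lam W W' t)) := fun t ↦
    Measure.isProbabilityMeasure_map (hm t).aemeasurable
  refine ⟨hprob 1, fun n hn ↦ ⟨P.map (levyPair α β δ μ lam W W' (1 / n)), hprob _, ?_⟩⟩
  have hsm : Measurable fun x : Fin n → ℝ × ℝ ↦ ∑ i, x i := by fun_prop
  have := Measure.isProbabilityMeasure_map
    (μ := Measure.pi fun _ : Fin n ↦ P.map (levyPair α β δ μ lam W W' (1 / n))) hsm.aemeasurable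
  refine Measure.ext_of_charFunDual ?_
  rw [charFunDual_map_sum_pi_eq_prod]
  ext ℓ
  have hn0 : (n : ℂ) ≠ 0 := by exact_mod_cast (by lia : n ≠ 0)
  rw [Finset.prod_const, Finset.card_univ, Fintype.card_fin, Pi.pow_apply,
    charFunDual_levyPair hαβ hδ hW hW' hind hpass, charFunDual_levyPair hαβ hδ hW hW' hind hpass,
    ← Complex.exp_nat_mul]
  congr 1
  push_cast
  field_simp

/-- A Brownian motion has a version that is continuous and starts at `0` everywhere, and exceeds
every level along every path once the drift `c ≥ 0` is added. -/
lemma exists_regular_version [IsProbabilityMeasure P] {c : ℝ} (hc : 0 ≤ c)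
    (hW : IsBrownianReal W P) :
    ∃ V : ℝ≥0 → Ω → ℝ, IsRegularBM V P ∧ (∀ ω, ∀ x : ℝ, ∃ r : ℝ≥0, x < c * r + V r ω) ∧
      ∀ᵐ ω ∂P, ∀ t, W t ω = V t ω := by
  obtain ⟨V, hVm, hVQ, hV⟩ := exists_version (Q := fun f ↦ Continuous f ∧ f 0 = 0)
    (fun f hf ↦ hf.1) ⟨NNReal.continuous_coe, NNReal.coe_zero⟩ (fun t ↦ hW.aemeasurable t)
    (hW.cont.and hW.eval_zero_ae_eq_zero)
  have hVreg : IsRegularBM V P :=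
    { toIsPreBrownianReal := hW.toIsPreBrownianReal.congr fun t ↦ hV.mono fun ω hω ↦ hω t
      measurable := hVm
      continuous := fun ω ↦ (hVQ ω).1
      zero := fun ω ↦ (hVQ ω).2 }
  obtain ⟨U, hUm, hUQ, hU⟩ := exists_version
    (Q := fun f ↦ (Continuous f ∧ f 0 = 0) ∧ ∀ x : ℝ, ∃ r : ℝ≥0, x < c * r + f r)
    (fun f hf ↦ hf.1.1)
    ⟨⟨NNReal.continuous_coe, NNReal.coe_zero⟩, fun x ↦ by
      obtain ⟨n, hn⟩ := exists_nat_gt x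
      refine ⟨n, ?_⟩
      have : 0 ≤ c * ((n : ℝ≥0) : ℝ) := by positivity
      push_cast at this ⊢
      linarith⟩
    (fun t ↦ (hVm t).aemeasurable)
    ((ae_of_all P fun ω ↦ hVQ ω).and (ae_exists_lt hVreg hc))
  refine ⟨U, ?_, fun ω ↦ (hUQ ω).2, ?_⟩
  · exact
      { toIsPreBrownianReal := hVreg.toIsPreBrownianReal.congr fun t ↦ hU.mono fun ω hω ↦ hω t
        measurable := hUm
        continuous := fun ω ↦ (hUQ ω).1.1
        zero := fun ω ↦ (hUQ ω).1.2 }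
  · filter_upwards [hV, hU] with ω h1 h2 t
    rw [h1, h2]

end Levy

end NIGIG

theorem lemma3p2 {Ω : Type u} [MeasurableSpace Ω] (P : Measure Ω) [IsProbabilityMeasure P]
    (α β δ μ lam : ℝ) (hαβ : |β| ≤ α) (hδ : 0 < δ) (hlam : 0 < lam)
    (W W' : ℝ≥0 → Ω → ℝ) (hW : NIGIG.IsBrownianPair W W' P) :
    -- the hitting times are almost surely finite
    (∀ t : ℝ≥0, ∀ᵐ ω ∂P,
      (NIGIG.passageTimes (Real.sqrt (α ^ 2 - β ^ 2)) W (δ * t) ω).Nonempty) ∧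
    -- the characteristic function of `(Z_t, λ Λ_t)`
    (∀ (t : ℝ≥0) (u v : ℝ),
      NIGIG.jointCharFun P (NIGIG.subordinatedProcess α β δ μ W W' t)
          (fun ω ↦ lam * NIGIG.hittingProcess α β δ W t ω) u v =
        Complex.exp (NIGIG.exponent α β δ μ lam u v * t)) ∧
    -- `η` is the logarithm (continuous, zero at the origin) of the characteristic function
    -- of `(Z_1, λ Λ_1)`
    Continuous (fun p : ℝ × ℝ ↦ NIGIG.exponent α β δ μ lam p.1 p.2) ∧
    NIGIG.exponent α β δ μ lam 0 0 = 0 ∧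
    (∀ u v : ℝ,
      NIGIG.jointCharFun P (NIGIG.subordinatedProcess α β δ μ W W' 1)
          (fun ω ↦ lam * NIGIG.hittingProcess α β δ W 1 ω) u v =
        Complex.exp (NIGIG.exponent α β δ μ lam u v)) ∧
    -- the law of `(Z_1, λ Λ_1)` is infinitely divisible
    NIGIG.IsInfinitelyDivisible
      (P.map fun ω ↦ (NIGIG.subordinatedProcess α β δ μ W W' 1 ω,
        lam * (NIGIG.hittingProcess α β δ W 1 ω : ℝ))) ∧
    -- NIG-IG processes with these parameters exist
    (∃ (Ω' : Type u) (_ : MeasurableSpace Ω') (P' : Measure Ω') (L : ℝ≥0 → Ω' → ℝ × ℝ),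
      IsProbabilityMeasure P' ∧ NIGIG.IsProcess α β δ μ lam L P') := by
  set c := Real.sqrt (α ^ 2 - β ^ 2) with hcdef
  obtain ⟨V, hV, hpass, hWV⟩ := NIGIG.exists_regular_version (Real.sqrt_nonneg _ : 0 ≤ c) hW.fst
  obtain ⟨V', hV', -, hWV'⟩ := NIGIG.exists_regular_version le_rfl hW.snd
  have hind : IndepFun (fun ω t ↦ V t ω) (fun ω t ↦ V' t ω) P :=
    hW.indep.congr (hWV.mono fun ω h ↦ funext h) (hWV'.mono fun ω h ↦ funext h)
  have hpair : ∀ t : ℝ≥0, (fun ω ↦ (NIGIG.subordinatedProcess α β δ μ W W' t ω,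
      lam * (NIGIG.hittingProcess α β δ W t ω : ℝ))) =ᵐ[P]
      NIGIG.levyPair α β δ μ lam V V' t := by
    intro t
    filter_upwards [hWV, hWV', NIGIG.passageTime_eq_sInf_ae hV hpass
      (by positivity : 0 ≤ δ * (t : ℝ))] with ω h h' hT
    have hΛ : NIGIG.hittingProcess α β δ W t ω = NIGIG.passageTime c V (δ * t) ω := by
      rw [← hT, NIGIG.hittingProcess, NIGIG.passageTimes]
      simp only [h, ← hcdef]
    simp only [NIGIG.subordinatedProcess, NIGIG.levyPair, hΛ, h', ← hcdef]
  have hchar : ∀ (t : ℝ≥0) (u v : ℝ),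
      NIGIG.jointCharFun P (NIGIG.subordinatedProcess α β δ μ W W' t)
          (fun ω ↦ lam * NIGIG.hittingProcess α β δ W t ω) u v =
        Complex.exp (NIGIG.exponent α β δ μ lam u v * t) := by
    intro t u v
    rw [← NIGIG.jointCharFun_levyPair hαβ hδ hV hV' hind hpass]
    refine integral_congr_ae ?_
    filter_upwards [hpair t] with ω hω
    simp only [← hω]
  refine ⟨fun t ↦ ?_, hchar, NIGIG.continuous_exponent hαβ, NIGIG.exponent_zero hαβ,
    fun u v ↦ by simpa using hchar 1 u v, ?_, ?_⟩
  · filter_upwards [hWV] with ω h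
    obtain ⟨r, hr⟩ := hpass ω (δ * t)
    refine ⟨r, ?_⟩
    change δ * t ≤ c * r + W r ω
    rw [h]
    exact hr.le
  · rw [Measure.map_congr (hpair 1)]
    exact NIGIG.isInfinitelyDivisible_levyPair hαβ hδ hV hV' hind hpass
  · exact ⟨Ω, inferInstance, P, NIGIG.levyPair α β δ μ lam V V', inferInstance,
      NIGIG.isProcess_levyPair hαβ hδ hV hV' hind hpass⟩
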